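/- A signed graph $\Gamma=(G,\sigma)$ is a finite simple graph $G$ with a map $\sigma:E(G)\to\{1,-1\}$. Its adjacency matrix has the entry $\sigma(ij)$ if $ij\in E(G)$ and $0$ otherwise, and its Estrada index is $EE(\Gamma)=\sum_{i=1}^n e^{\mu_i}$, where $\mu_1,\dots,\mu_n$ are the eigenvalues of this matrix, with multiplicity. $\Gamma$ has the pairing property if, for every real $\mu$, $\mu$ and $-\mu$ have the same (possibly zero) multiplicity as eigenvalues. $\Gamma$ is unicyclic if $G$ is connected with as many edges as vertices, and bipartite if $G$ is. $\Gamma$ is unbalanced if some cycle of $G$ has an odd number of negative edges. Switching at a vertex set $Z$ reverses the signs of all edges between $Z$ and its complement; $\Gamma$ is switching equivalent to $\Delta$ if some switching of $\Gamma$ is isomorphic to $\Delta$ by a graph isomorphism that preserves the edge signs. **Theorem.** (a) A unicyclic signed graph has the pairing property if and only if it is bipartite. In particular, the unbalanced bipartite unicyclic signed graphs are exactly the unbalanced unicyclic signed graphs with the pairing property. (b) Let $n\ge 4$, and let $\Gamma_n^{4-}$ be the signed graph on $n$ vertices that consists of a 4-cycle with exactly one negative edge and of $n-4$ pendant vertices,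 all attached by positive edges to one vertex of the cycle, which is an end of the negative edge. Then $\Gamma_n^{4-}$ is an unbalanced bipartite unicyclic signed graph, and every unbalanced bipartite unicyclic signed graph $\Gamma$ on $n$ vertices satisfies $$EE(\Gamma)\le EE(\Gamma_n^{4-}),$$ with equality if and only if $\Gamma$ is switching equivalent to $\Gamma_n^{4-}$. -/

import Mathlib

/-- A signed graph on the vertex set `V`: a simple graph with a map from its edges to `{1, -1}`. -/
structure SignedGraph (V : Type*) where
  graph : SimpleGraph V
  sign : graph.edgeSet → ℤˣ

namespace SignedGraph

open Classical in
/-- The signed adjacency matrix: the sign of the edge `ij` if `i` and `j` are adjacent, and `0`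
otherwise. -/
noncomputable def adjMatrix {V : Type*} (Γ : SignedGraph V) : Matrix V V ℝ :=
  Matrix.of fun i j => if h : Γ.graph.Adj i j then (((Γ.sign ⟨s(i, j), h⟩ : ℤˣ) : ℤ) : ℝ) else 0

theorem adjMatrix_isHermitian {V : Type*} (Γ : SignedGraph V) : Γ.adjMatrix.IsHermitian := by
  ext i j
  simp only [adjMatrix, Matrix.conjTranspose_apply, Matrix.of_apply, star_trivial]
  by_cases h : Γ.graph.Adj i j
  · have e : (⟨s(j, i), h.symm⟩ : Γ.graph.edgeSet) = ⟨s(i, j), h⟩ := Subtype.ext Sym2.eq_swap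
    rw [dif_pos h, dif_pos h.symm, e]
  · rw [dif_neg h, dif_neg fun h' => h h'.symm]

open Classical in
/-- The Estrada index: the sum of `exp μ` over the eigenvalues `μ` of the adjacency matrix, with
multiplicity. -/
noncomputable def estradaIndex {V : Type*} [Fintype V] (Γ : SignedGraph V) : ℝ :=
  ∑ i, Real.exp (Γ.adjMatrix_isHermitian.eigenvalues i)

open Classical in
/-- The pairing property: `μ` and `-μ` are eigenvalues of the same multiplicity (possibly zero),
for every `μ`. -/
def PairingProperty {V : Type*} [Fintype V] (Γ : SignedGraph V) : Prop :=
  ∀ μ : ℝ, Γ.adjMatrix.charpoly.rootMultiplicity (-μ) = Γ.adjMatrix.charpoly.rootMultiplicity μ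

/-- The sign of a walk: the product of the signs of its edges. -/
def walkSign {V : Type*} (Γ : SignedGraph V) {u v : V} (p : Γ.graph.Walk u v) : ℤˣ :=
  (p.darts.map fun d => Γ.sign ⟨d.edge, d.edge_mem⟩).prod

/-- A signed graph is balanced if all of its cycles are positive. -/
def IsBalanced {V : Type*} (Γ : SignedGraph V) : Prop :=
  ∀ (v : V) (p : Γ.graph.Walk v v), p.IsCycle → Γ.walkSign p = 1

/-- A signed graph is unicyclic if it is connected, with as many edges as vertices. -/
def IsUnicyclic {V : Type*} [Fintype V] (Γ : SignedGraph V) : Prop :=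
  Γ.graph.Connected ∧ Γ.graph.edgeSet.ncard = Fintype.card V

open Classical in
/-- Switching at `Z`: the signs of the edges between `Z` and its complement are reversed. -/
noncomputable def switch {V : Type*} (Γ : SignedGraph V) (Z : Set V) : SignedGraph V where
  graph := Γ.graph
  sign e := if ∃ u ∈ Z, ∃ v ∉ Z, (e : Sym2 V) = s(u, v) then -Γ.sign e else Γ.sign e

/-- Isomorphism of signed graphs: a graph isomorphism that preserves the signs of all edges. -/
def IsIsomorphic {V W : Type*} (Γ : SignedGraph V) (Δ : SignedGraph W) : Prop :=
  ∃ f : Γ.graph ≃g Δ.graph, ∀ e : Γ.graph.edgeSet, Δ.sign (f.mapEdgeSet e) = Γ.sign e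

/-- Switching equivalence, where isomorphic signed graphs are identified. -/
def SwitchingEquivalent {V W : Type*} (Γ : SignedGraph V) (Δ : SignedGraph W) : Prop :=
  ∃ Z : Set V, (Γ.switch Z).IsIsomorphic Δ

/-- The class of unbalanced bipartite unicyclic signed graphs. -/
def IsUnbalancedBipartiteUnicyclic {V : Type*} [Fintype V] (Γ : SignedGraph V) : Prop :=
  Γ.IsUnicyclic ∧ Γ.graph.IsBipartite ∧ ¬ Γ.IsBalanced

open Classical in
/-- For `4 ≤ n`: the negative 4-cycle `0, 1, 2, 3`, in which the edge between `0` and `3` is the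
only negative one, with the `n - 4` further vertices `4, …, n - 1` attached to the vertex `0` as
pendant vertices by positive edges. -/
noncomputable def negFourCycleWithPendants (n : ℕ) : SignedGraph (Fin n) where
  graph := SimpleGraph.fromRel fun i j : Fin n =>
    ((i : ℕ) = 0 ∧ (j : ℕ) = 1) ∨ ((i : ℕ) = 1 ∧ (j : ℕ) = 2) ∨ ((i : ℕ) = 2 ∧ (j : ℕ) = 3) ∨
      ((i : ℕ) = 0 ∧ (j : ℕ) = 3) ∨ ((i : ℕ) = 0 ∧ 4 ≤ (j : ℕ))
  sign e := if ∃ i j : Fin n, (i : ℕ) = 0 ∧ (j : ℕ) = 3 ∧ (e : Sym2 (Fin n)) = s(i, j)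
    then -1 else 1

end SignedGraph

/-! Part (a). For a bipartite graph, changing the sign of one colour class conjugates the adjacency
matrix `A` to `-A`, so the spectrum is symmetric. Conversely, a unicyclic graph is a spanning tree
plus one edge. Signs on the tree can be switched away, and if the graph is not bipartite, the sign
of the remaining edge can be absorbed by replacing `A` with `-A`. So `A` is switching equivalent to
plus or minus the unsigned adjacency matrix, and an odd closed walk makes the trace of some odd
power nonzero, which the pairing property forbids.

Part (b). In the bipartite case only even powers of `A` have a trace, and `tr A^(2k)` is twice the
trace of the `k`-th power of the Gram matrix of the columns in either colour class. The eigenvalues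
of this Gram matrix are nonnegative and their sum is the number of edges, which is `n`. A negative
even cycle forces two of them to be at least 2: subspaces of vectors supported on the cycle show
this for lengths 4, 6 and at least 8. By convexity the sum of the `k`-th powers is at most `(n -
2)^k + 2^k`. The signed graph `negFourCycleWithPendants n` has Gram eigenvalues `n - 2`, `2` and
zeros, so it attains all these bounds at once, and the exponential series is compared term by term.

If the Estrada indices agree, so do all terms. The case `k = 2` shows, for both colour classes, that
all eigenvalues but one are at most 2 and that at most two are nonzero. A 6-cycle has two
eigenvalues at least 3, and a longer cycle gives rank at least 3, so the cycle has length 4. The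
same two restrictions force all other vertices to hang from one vertex of the cycle, and counting
edges and switching identify the graph. -/

open Matrix

/-! ### Eigenvalue bounds from test subspaces -/

namespace Matrix.IsHermitian

variable {n : Type*} [Fintype n] [DecidableEq n] {A : Matrix n n ℝ}

theorem trace_pow_eq_sum_eigenvalues_pow (hA : A.IsHermitian) (k : ℕ) :
    (A ^ k).trace = ∑ i, hA.eigenvalues i ^ k := by
  conv_lhs => rw [hA.spectral_theorem, ← map_pow, Unitary.conjStarAlgAut_apply, trace_mul_cycle]
  simp [diagonal_pow, trace_diagonal]

theorem charpoly_neg_eq (hA : A.IsHermitian) :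
    (-A).charpoly = ∏ i, (Polynomial.X - Polynomial.C (-hA.eigenvalues i)) := by
  conv_lhs => rw [hA.spectral_theorem, ← map_neg, Unitary.conjStarAlgAut_apply,
    charpoly_mul_comm, ← mul_assoc]
  simp [charpoly_diagonal, diagonal_neg, charpoly_diagonal]

/-- A space of dimension greater than `#T` contains a nonzero vector that is orthogonal to the
eigenvectors with index in `T`. -/
theorem exists_ne_zero_coords (hA : A.IsHermitian) (T : Finset n) {k : ℕ} (hk : T.card < k)
    (L : (Fin k → ℝ) →ₗ[ℝ] (n → ℝ)) :
    ∃ t ≠ 0, ∃ c : n → ℝ, (∀ j ∈ T, c j = 0) ∧ L t ⬝ᵥ L t = ∑ j, c j ^ 2 ∧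
      L t ⬝ᵥ A *ᵥ L t = ∑ j, hA.eigenvalues j * c j ^ 2 := by
  set U : Matrix n n ℝ := (hA.eigenvectorUnitary : Matrix n n ℝ)
  have hU : U * Uᵀ = 1 := by
    have := Unitary.coe_mul_star_self hA.eigenvectorUnitary
    simpa [star_eq_conjTranspose, U] using this
  have hAU : A = U * diagonal hA.eigenvalues * Uᵀ := by
    have := hA.spectral_theorem
    rw [Unitary.conjStarAlgAut_apply] at this
    simpa [star_eq_conjTranspose, U, Function.comp_def] using this
  -- The `T`-coordinates of `L t` in the eigenbasis are `#T < k` linear conditions on `t`, so they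
  -- have a nonzero common solution.
  let M : (Fin k → ℝ) →ₗ[ℝ] (T → ℝ) :=
    (LinearMap.funLeft ℝ ℝ (fun j : T => (j : n))) ∘ₗ (Matrix.mulVecLin Uᵀ) ∘ₗ L
  obtain ⟨t, htk, ht0⟩ := (Submodule.ne_bot_iff _).1
    (LinearMap.ker_ne_bot_of_finrank_lt (f := M) (by simpa using hk))
  refine ⟨t, ht0, Uᵀ *ᵥ L t, fun j hj => ?_, ?_, ?_⟩
  · exact congrFun (LinearMap.mem_ker.1 htk) ⟨j, hj⟩
  · have : L t ⬝ᵥ L t = (Uᵀ *ᵥ L t) ⬝ᵥ (Uᵀ *ᵥ L t) := by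
      rw [dotProduct_mulVec, vecMul_transpose, mulVec_mulVec, hU, one_mulVec]
    rw [this]
    simp [dotProduct, pow_two]
  · have : L t ⬝ᵥ A *ᵥ L t = (Uᵀ *ᵥ L t) ⬝ᵥ (diagonal hA.eigenvalues *ᵥ (Uᵀ *ᵥ L t)) := by
      conv_lhs => rw [hAU]
      rw [← mulVec_mulVec, ← mulVec_mulVec, dotProduct_mulVec, ← mulVec_transpose]
    rw [this]
    simp only [dotProduct, mulVec_diagonal]
    exact Finset.sum_congr rfl fun j _ => by ring

/-- Otherwise a nonzero vector in the range of `L`, orthogonal to the eigenvectors in `T`, would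
have Rayleigh quotient less than `c`. With `T = {i}` and `k = 2` this produces a second large
eigenvalue without ordering the spectrum. -/
theorem exists_le_eigenvalue (hA : A.IsHermitian) (T : Finset n) {k : ℕ} (hk : T.card < k)
    (L : (Fin k → ℝ) →ₗ[ℝ] (n → ℝ)) (hL : Function.Injective L) (c : ℝ)
    (h : ∀ t, c * (L t ⬝ᵥ L t) ≤ L t ⬝ᵥ A *ᵥ L t) : ∃ j ∉ T, c ≤ hA.eigenvalues j := by
  obtain ⟨t, ht, x, hxT, h1, h2⟩ := hA.exists_ne_zero_coords T hk L
  by_contra! hlt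
  have hpos : 0 < ∑ j, x j ^ 2 := by
    rw [← h1]
    have : L t ≠ 0 := fun h0 => ht (hL (by rw [h0, map_zero]))
    refine lt_of_le_of_ne ?_ fun h0 => this (dotProduct_self_eq_zero.1 h0.symm)
    simpa [dotProduct] using Finset.sum_nonneg fun i _ => mul_self_nonneg (L t i)
  obtain ⟨j, -, hj⟩ := Finset.exists_lt_of_sum_lt (f := fun _ => (0 : ℝ)) (by simpa using hpos)
  have := h t
  rw [h1, h2, Finset.mul_sum] at this
  refine absurd this (not_le.2 (Finset.sum_lt_sum (fun i _ => ?_) ⟨j, Finset.mem_univ _, ?_⟩))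
  · by_cases hi : i ∈ T
    · simp [hxT i hi]
    · exact mul_le_mul_of_nonneg_right (hlt i hi).le (sq_nonneg _)
  · by_cases hi : j ∈ T
    · simp [hxT j hi] at hj
    · exact mul_lt_mul_of_pos_right (hlt j hi) hj

theorem exists_eigenvalue_pos (hA : A.IsHermitian) (T : Finset n) {k : ℕ} (hk : T.card < k)
    (L : (Fin k → ℝ) →ₗ[ℝ] (n → ℝ)) (h : ∀ t ≠ 0, 0 < L t ⬝ᵥ A *ᵥ L t) :
    ∃ j ∉ T, 0 < hA.eigenvalues j := by
  obtain ⟨t, ht, x, hxT, h1, h2⟩ := hA.exists_ne_zero_coords T hk L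
  by_contra! hle
  refine absurd (h t ht) (not_lt.2 ?_)
  rw [h2]
  refine Finset.sum_nonpos fun i _ => ?_
  by_cases hi : i ∈ T
  · simp [hxT i hi]
  · exact mul_nonpos_of_nonpos_of_nonneg (hle i hi) (sq_nonneg _)

end Matrix.IsHermitian

/-! ### Power sums of nonnegative reals with a given sum -/

section PowerSums

variable {ι : Type*} [Fintype ι] {y : ι → ℝ} {m : ℝ}

/-- The points `x` and `m - x` lie symmetrically in `[2, m - 2]`, and a convex function lies below
its chord there. The chord values at the two points add up to the sum of the end values. -/
theorem pow_add_pow_le_of_mem_Icc {x : ℝ} (hx : x ∈ Set.Icc 2 (m - 2)) (k : ℕ) :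
    x ^ k + (m - x) ^ k ≤ (m - 2) ^ k + 2 ^ k := by
  obtain ⟨h1, h2⟩ := hx
  -- For `m = 4` the interval is a point and the slope of the chord is undefined.
  rcases eq_or_lt_of_le (h1.trans h2) with h | h
  · have : x = 2 := by linarith
    subst this
    exact (add_comm _ _).le
  have hd : 0 < m - 4 := by linarith
  have hc := convexOn_pow (𝕜 := ℝ) k
  have key : ∀ z ∈ Set.Icc 2 (m - 2), z ^ k ≤
      (m - 2 - z) / (m - 4) * 2 ^ k + (z - 2) / (m - 4) * (m - 2) ^ k := by
    rintro z ⟨hz1, hz2⟩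
    have ha : 0 ≤ (m - 2 - z) / (m - 4) := div_nonneg (by linarith) hd.le
    have hb : 0 ≤ (z - 2) / (m - 4) := div_nonneg (by linarith) hd.le
    have hm2 : m - 2 ∈ Set.Ici (0 : ℝ) := Set.mem_Ici.2 (by linarith)
    have := hc.2 (Set.mem_Ici.2 zero_le_two) hm2 ha hb (by field_simp; ring)
    simp only [smul_eq_mul] at this
    have hz : (m - 2 - z) / (m - 4) * 2 + (z - 2) / (m - 4) * (m - 2) = z := by
      field_simp
      ring
    rwa [hz] at this
  have e1 := key x ⟨h1, h2⟩
  have e2 := key (m - x) ⟨by linarith, by linarith⟩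
  refine (add_le_add e1 e2).trans (le_of_eq ?_)
  field_simp
  ring

/-- The hypothesis `h2` says that at least two terms, counted with multiplicity, are at least 2. The
maximum is one of them, and the other keeps it below `m - 2`. -/
theorem exists_max_of_sum_eq (hy : ∀ i, 0 ≤ y i) (hs : ∑ i, y i = m)
    (h2 : ∀ i, ∃ j ≠ i, 2 ≤ y j) (hm : 0 < m) :
    ∃ i, (∀ j, y j ≤ y i) ∧ y i ∈ Set.Icc 2 (m - 2) := by
  classical
  have : Nonempty ι := by
    by_contra h
    rw [not_nonempty_iff] at h
    simp at hs
    exact hm.ne hs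
  obtain ⟨i, -, hi⟩ := Finset.exists_max_image Finset.univ y Finset.univ_nonempty
  obtain ⟨j, hj, hj2⟩ := h2 i
  refine ⟨i, fun j => hi j (Finset.mem_univ _), hj2.trans (hi j (Finset.mem_univ _)), ?_⟩
  have := Finset.sum_le_sum_of_subset_of_nonneg (Finset.subset_univ {i, j})
    (fun l _ _ => hy l)
  rw [Finset.sum_pair hj.symm, hs] at this
  linarith

theorem sum_pow_le_pow_sum_of_nonneg {κ : Type*} (s : Finset κ) (z : κ → ℝ) (hz : ∀ i, 0 ≤ z i)
    {k : ℕ} (hk : k ≠ 0) : ∑ i ∈ s, z i ^ k ≤ (∑ i ∈ s, z i) ^ k := by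
  obtain ⟨k, rfl⟩ := Nat.exists_eq_succ_of_ne_zero hk
  rw [Nat.succ_eq_add_one, pow_succ', Finset.sum_mul]
  refine Finset.sum_le_sum fun i hi => ?_
  rw [pow_succ']
  exact mul_le_mul_of_nonneg_left
    (pow_le_pow_left₀ (hz i) (Finset.single_le_sum (fun j _ => hz j) hi) k) (hz i)

/-- Merging all terms other than the largest into one term can only increase the power sum. The two
remaining terms are covered by `pow_add_pow_le_of_mem_Icc`. -/
theorem sum_pow_le_of_sum_eq (hy : ∀ i, 0 ≤ y i) (hs : ∑ i, y i = m)
    (h2 : ∀ i, ∃ j ≠ i, 2 ≤ y j) (hm : 0 < m) {k : ℕ} (hk : k ≠ 0) :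
    ∑ i, y i ^ k ≤ (m - 2) ^ k + 2 ^ k := by
  classical
  obtain ⟨i, -, hi⟩ := exists_max_of_sum_eq hy hs h2 hm
  refine le_trans ?_ (pow_add_pow_le_of_mem_Icc hi k)
  rw [← Finset.add_sum_erase _ _ (Finset.mem_univ i)] at hs ⊢
  rw [← hs, add_sub_cancel_left]
  gcongr
  exact sum_pow_le_pow_sum_of_nonneg _ _ hy hk

/-- Equality for squares rules out any gain from merging: the remainder `r` beyond the two large
terms `a ≥ b` satisfies `b * r ≤ 0`, hence vanishes. Then `(a - 2) * (b - 2) = 0`, so `b = 2`. -/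
theorem of_sum_sq_eq (hy : ∀ i, 0 ≤ y i) (hs : ∑ i, y i = m)
    (h2 : ∀ i, ∃ j ≠ i, 2 ≤ y j) (hm : 0 < m) (hsq : ∑ i, y i ^ 2 = (m - 2) ^ 2 + 2 ^ 2) :
    (∃ i, ∀ j ≠ i, y j ≤ 2) ∧ ∃ T : Finset ι, T.card < 3 ∧ ∀ j ∉ T, y j = 0 := by
  classical
  obtain ⟨i, hmax, hi⟩ := exists_max_of_sum_eq hy hs h2 hm
  obtain ⟨j, hj, hj2⟩ := h2 i
  rw [← Finset.add_sum_erase _ _ (Finset.mem_univ i)] at hs hsq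
  have hji : j ∈ Finset.univ.erase i := by simp [hj]
  rw [← Finset.add_sum_erase _ _ hji] at hs hsq
  set r := ∑ l ∈ (Finset.univ.erase i).erase j, y l with hr
  have hr0 : 0 ≤ r := Finset.sum_nonneg fun l _ => hy l
  have hle := sum_pow_le_pow_sum_of_nonneg ((Finset.univ.erase i).erase j) y hy two_ne_zero
  rw [← hr] at hle
  have hp := pow_add_pow_le_of_mem_Icc hi 2
  have hjr : y j * r ≤ 0 := by
    have : m - y i = y j + r := by linarith
    rw [this] at hp
    nlinarith
  have hr00 : r = 0 := by nlinarith
  have hz : ∀ l, l ≠ i → l ≠ j → y l = 0 := fun l h1 h2 =>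
    (Finset.sum_eq_zero_iff_of_nonneg fun l _ => hy l).1 (hr.symm.trans hr00) l (by simp [h1, h2])
  have hsq' : ∑ l ∈ (Finset.univ.erase i).erase j, y l ^ 2 = 0 :=
    Finset.sum_eq_zero fun l hl => by
      simp only [Finset.mem_erase, Finset.mem_univ, and_true] at hl
      simp [hz l hl.2 hl.1]
  refine ⟨⟨i, fun l hl => ?_⟩, {i, j}, lt_of_le_of_lt Finset.card_le_two (by norm_num),
    fun l hl => ?_⟩
  · by_cases hlj : l = j
    · subst hlj
      have hm' : m = y i + y l := by linarith
      rw [hsq', hm'] at hsq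
      have := hmax l
      nlinarith
    · rw [hz l hl hlj]; norm_num
  · simp only [Finset.mem_insert, Finset.mem_singleton, not_or] at hl
    exact hz l hl.1 hl.2

end PowerSums

/-! ### Switching and Gram matrices of bipartite matrices -/

namespace Matrix

variable {V : Type*} [Fintype V] [DecidableEq V]

theorem diagonal_conj_pow (A : Matrix V V ℝ) {θ : V → ℝ} (hθ : ∀ v, θ v * θ v = 1) (k : ℕ) :
    (diagonal θ * A * diagonal θ) ^ k = diagonal θ * A ^ k * diagonal θ := by
  have hD : diagonal θ * diagonal θ = 1 := by simp [hθ]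
  induction k with
  | zero => simp [hθ]
  | succ k ih =>
    rw [pow_succ, ih, pow_succ]
    calc _ = diagonal θ * A ^ k * (diagonal θ * diagonal θ) * A * diagonal θ := by
            simp only [Matrix.mul_assoc]
      _ = _ := by rw [hD]; simp only [Matrix.mul_assoc, Matrix.one_mul]

theorem trace_diagonal_conj_pow (A : Matrix V V ℝ) {θ : V → ℝ} (hθ : ∀ v, θ v * θ v = 1) (k : ℕ) :
    ((diagonal θ * A * diagonal θ) ^ k).trace = (A ^ k).trace := by
  rw [diagonal_conj_pow A hθ, trace_mul_cycle]
  simp [hθ]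

theorem charpoly_diagonal_conj (A : Matrix V V ℝ) {θ : V → ℝ} (hθ : ∀ v, θ v * θ v = 1) :
    (diagonal θ * A * diagonal θ).charpoly = A.charpoly := by
  rw [charpoly_mul_comm, ← Matrix.mul_assoc]
  simp [hθ]

/-- The nonzero entries of `A` connect the two colour classes of `c`. -/
def IsColoredBy {V : Type*} (A : Matrix V V ℝ) (c : V → Bool) : Prop :=
  ∀ u v, A u v ≠ 0 → c u ≠ c v

/-- The projection to a colour class. -/
def colorProj (c : V → Bool) (κ : Bool) : Matrix V V ℝ :=
  diagonal fun v => if c v = κ then 1 else 0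

/-- The Gram matrix of the columns of `A` in a colour class. -/
def colorGram (A : Matrix V V ℝ) (c : V → Bool) (κ : Bool) : Matrix V V ℝ :=
  (A * colorProj c κ)ᴴ * (A * colorProj c κ)

theorem colorGram_posSemidef (A : Matrix V V ℝ) (c : V → Bool) (κ : Bool) :
    (colorGram A c κ).PosSemidef :=
  posSemidef_conjTranspose_mul_self _

theorem dotProduct_colorGram_mulVec (A : Matrix V V ℝ) (c : V → Bool) (κ : Bool) {x : V → ℝ}
    (hx : ∀ v, c v ≠ κ → x v = 0) :
    x ⬝ᵥ colorGram A c κ *ᵥ x = (A *ᵥ x) ⬝ᵥ (A *ᵥ x) := by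
  have hP : colorProj c κ *ᵥ x = x := by
    ext v
    rw [colorProj, mulVec_diagonal]
    by_cases h : c v = κ
    · simp [h]
    · simp [h, hx v h]
  rw [colorGram, ← mulVec_mulVec, dotProduct_mulVec, conjTranspose_eq_transpose_of_trivial,
    vecMul_transpose, ← mulVec_mulVec, hP]

variable {A : Matrix V V ℝ} {c : V → Bool}

/-- Every nonzero entry joins the two classes, so exactly one of its two factors is `-1`. -/
theorem IsColoredBy.neg_eq (hc : IsColoredBy A c) :
    diagonal (fun v => if c v then 1 else -1) * A * diagonal (fun v => if c v then 1 else -1)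
      = -A := by
  ext u v
  rw [mul_diagonal, diagonal_mul, neg_apply]
  by_cases h : A u v = 0
  · simp [h]
  · have := hc u v h
    cases hu : c u <;> cases hv : c v <;> simp_all

theorem IsColoredBy.trace_pow_odd (hc : IsColoredBy A c) {k : ℕ} (hk : Odd k) :
    (A ^ k).trace = 0 := by
  have h := trace_diagonal_conj_pow A (θ := fun v => if c v then 1 else -1)
    (fun v => by split_ifs <;> simp) k
  rw [hc.neg_eq, hk.neg_pow, trace_neg] at h
  linarith

theorem IsColoredBy.colorProj_mul (hc : IsColoredBy A c) (κ : Bool) :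
    colorProj c κ * A = A * colorProj c (!κ) := by
  ext u v
  rw [colorProj, colorProj, mul_diagonal, diagonal_mul]
  by_cases h : A u v = 0
  · simp [h]
  · have := hc u v h
    cases hu : c u <;> cases hv : c v <;> cases κ <;> simp_all

theorem colorProj_mul_self (c : V → Bool) (κ : Bool) :
    colorProj c κ * colorProj c κ = colorProj c κ := by
  simp [colorProj]

theorem colorProj_add {V : Type*} [DecidableEq V] (c : V → Bool) (κ : Bool) : colorProj c κ + colorProj c (!κ) = 1 := by
  rw [colorProj, colorProj, diagonal_add, ← diagonal_one]
  congr 1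
  ext v
  cases c v <;> cases κ <;> simp

theorem IsColoredBy.commute (hc : IsColoredBy A c) (κ : Bool) :
    Commute (colorProj c κ) (A * A) := by
  rw [Commute, SemiconjBy, ← Matrix.mul_assoc, hc.colorProj_mul, Matrix.mul_assoc,
    hc.colorProj_mul, Bool.not_not, Matrix.mul_assoc]

theorem IsColoredBy.colorGram_eq (hA : A.IsHermitian) (hc : IsColoredBy A c) (κ : Bool) :
    colorGram A c κ = colorProj c κ * (A * A) := by
  have hP : (colorProj c κ)ᴴ = colorProj c κ := by
    rw [colorProj, diagonal_conjTranspose, star_trivial]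
  rw [colorGram, conjTranspose_mul, hA.eq, hP]
  calc _ = colorProj c κ * (A * A) * colorProj c κ := by simp only [Matrix.mul_assoc]
    _ = _ := by rw [(hc.commute κ).eq, Matrix.mul_assoc, colorProj_mul_self]

theorem IsColoredBy.colorGram_pow (hA : A.IsHermitian) (hc : IsColoredBy A c) (κ : Bool)
    {k : ℕ} (hk : k ≠ 0) : colorGram A c κ ^ k = colorProj c κ * A ^ (2 * k) := by
  rw [hc.colorGram_eq hA, (hc.commute κ).mul_pow, pow_mul, pow_two,
    (show IsIdempotentElem (colorProj c κ) from colorProj_mul_self c κ).pow_eq hk]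

/-- The two colour classes contribute equally to the trace, because one factor `A` can be moved
cyclically past the projection and exchanges the classes. For `k = 0` this fails, since the classes
may differ in size. -/
theorem IsColoredBy.two_mul_trace_colorGram_pow (hA : A.IsHermitian) (hc : IsColoredBy A c)
    (κ : Bool) {k : ℕ} (hk : k ≠ 0) :
    2 * (colorGram A c κ ^ k).trace = (A ^ (2 * k)).trace := by
  obtain ⟨l, rfl⟩ := Nat.exists_eq_succ_of_ne_zero hk
  have h : (colorProj c κ * A ^ (2 * (l + 1))).trace
      = (colorProj c (!κ) * A ^ (2 * (l + 1))).trace := by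
    rw [show 2 * (l + 1) = (2 * l + 1) + 1 by ring, pow_succ', ← Matrix.mul_assoc,
      hc.colorProj_mul, Matrix.mul_assoc, trace_mul_comm A, Matrix.mul_assoc, ← pow_succ, pow_succ']
  rw [hc.colorGram_pow hA κ hk, two_mul]
  nth_rw 2 [h]
  rw [← trace_add, ← Matrix.add_mul, colorProj_add, Matrix.one_mul]

end Matrix

/-! ### Adjacency matrix, Estrada index and switching -/

namespace SignedGraph

section adjMatrix

variable {V : Type*} (Γ : SignedGraph V)

theorem adjMatrix_of_not_adj {u v : V} (h : ¬ Γ.graph.Adj u v) : Γ.adjMatrix u v = 0 := by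
  simp [adjMatrix, h]

theorem adjMatrix_of_adj {u v : V} (h : Γ.graph.Adj u v) :
    Γ.adjMatrix u v = ((Γ.sign ⟨s(u, v), h⟩ : ℤˣ) : ℤ) := by
  simp [adjMatrix, h]

theorem adjMatrix_eq_one_or {u v : V} (h : Γ.graph.Adj u v) :
    Γ.adjMatrix u v = 1 ∨ Γ.adjMatrix u v = -1 := by
  rw [Γ.adjMatrix_of_adj h]
  rcases Int.units_eq_one_or (Γ.sign ⟨s(u, v), h⟩) with e | e <;> simp [e]

theorem adjMatrix_mul_self {u v : V} (h : Γ.graph.Adj u v) :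
    Γ.adjMatrix u v * Γ.adjMatrix u v = 1 := by
  rcases Γ.adjMatrix_eq_one_or h with e | e <;> simp [e]

theorem adjMatrix_ne_zero {u v : V} : Γ.adjMatrix u v ≠ 0 ↔ Γ.graph.Adj u v := by
  refine ⟨fun h => ?_, fun h => ?_⟩
  · by_contra h'
    exact h (Γ.adjMatrix_of_not_adj h')
  · rcases Γ.adjMatrix_eq_one_or h with e | e <;> simp [e]

theorem adjMatrix_comm (u v : V) : Γ.adjMatrix u v = Γ.adjMatrix v u := by
  simpa using congrFun₂ Γ.adjMatrix_isHermitian v u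

theorem trace_adjMatrix_sq [Fintype V] [DecidableEq V] :
    (Γ.adjMatrix ^ 2).trace = 2 * (Γ.graph.edgeSet.ncard : ℝ) := by
  classical
  have h := Γ.graph.sum_degrees_eq_twice_card_edges
  have h2 : Γ.graph.edgeSet.ncard = Γ.graph.edgeFinset.card := by
    rw [← SimpleGraph.coe_edgeFinset, Set.ncard_coe_finset]
  rw [h2]
  have h3 : (2 : ℝ) * (Γ.graph.edgeFinset.card : ℝ) = ∑ v, (Γ.graph.degree v : ℝ) := by
    exact_mod_cast h.symm
  rw [h3, pow_two, trace]
  refine Finset.sum_congr rfl fun u _ => ?_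
  rw [diag_apply, mul_apply, ← SimpleGraph.card_neighborFinset_eq_degree, Finset.card_eq_sum_ones,
    Nat.cast_sum, SimpleGraph.neighborFinset_eq_filter, Finset.sum_filter]
  refine Finset.sum_congr rfl fun v _ => ?_
  rw [Γ.adjMatrix_comm v u]
  split_ifs with h
  · simpa using Γ.adjMatrix_mul_self h
  · simp [Γ.adjMatrix_of_not_adj h]

theorem exists_isColoredBy (h : Γ.graph.IsBipartite) [Fintype V] :
    ∃ c : V → Bool, Γ.adjMatrix.IsColoredBy c := by
  obtain ⟨C⟩ := h
  refine ⟨fun v => C v = 0, fun u v huv heq => ?_⟩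
  have := C.valid (Γ.adjMatrix_ne_zero.1 huv)
  simp only [decide_eq_decide] at heq
  omega

end adjMatrix

section estradaIndex

variable {V W : Type*} [Fintype V] [DecidableEq V] [Fintype W] [DecidableEq W]

theorem hasSum_estradaIndex (Γ : SignedGraph V) :
    HasSum (fun k : ℕ => (Γ.adjMatrix ^ k).trace / (k.factorial : ℝ)) Γ.estradaIndex := by
  have e : ‹DecidableEq V› = fun a b => Classical.propDecidable (a = b) := Subsingleton.elim _ _
  subst e
  classical
  simp_rw [Γ.adjMatrix_isHermitian.trace_pow_eq_sum_eigenvalues_pow, Finset.sum_div]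
  refine hasSum_sum fun i _ => ?_
  rw [Real.exp_eq_exp_ℝ]
  exact NormedSpace.expSeries_div_hasSum_exp _

theorem estradaIndex_eq_of_trace_pow (Γ : SignedGraph V) (Δ : SignedGraph W)
    (h : ∀ k, (Γ.adjMatrix ^ k).trace = (Δ.adjMatrix ^ k).trace) :
    Γ.estradaIndex = Δ.estradaIndex := by
  refine Γ.hasSum_estradaIndex.unique ?_
  simp_rw [h]
  exact Δ.hasSum_estradaIndex

theorem hasSum_estradaIndex_of_isColoredBy (Γ : SignedGraph V) {c : V → Bool}
    (hc : Γ.adjMatrix.IsColoredBy c) :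
    HasSum (fun k : ℕ => (Γ.adjMatrix ^ (2 * k)).trace / ((2 * k).factorial : ℝ))
      Γ.estradaIndex := by
  refine ((mul_right_injective₀ (two_ne_zero (α := ℕ))).hasSum_iff fun k hk => ?_).2
    Γ.hasSum_estradaIndex
  rw [hc.trace_pow_odd, zero_div]
  rw [← Nat.not_even_iff_odd]
  rintro ⟨l, rfl⟩
  exact hk ⟨l, by ring⟩

variable {Γ : SignedGraph V} {Δ : SignedGraph W} {c : V → Bool} {d : W → Bool} {κ κ' : Bool}

theorem trace_div_factorial_le (hV : Fintype.card V = Fintype.card W)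
    (hc : Γ.adjMatrix.IsColoredBy c) (hd : Δ.adjMatrix.IsColoredBy d)
    (h : ∀ k ≠ 0, (colorGram Γ.adjMatrix c κ ^ k).trace ≤ (colorGram Δ.adjMatrix d κ' ^ k).trace)
    (k : ℕ) : (Γ.adjMatrix ^ (2 * k)).trace / ((2 * k).factorial : ℝ) ≤
      (Δ.adjMatrix ^ (2 * k)).trace / ((2 * k).factorial : ℝ) := by
  gcongr
  rcases eq_or_ne k 0 with rfl | hk
  · simp [hV]
  · rw [← hc.two_mul_trace_colorGram_pow Γ.adjMatrix_isHermitian κ hk,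
      ← hd.two_mul_trace_colorGram_pow Δ.adjMatrix_isHermitian κ' hk]
    linarith [h k hk]

theorem estradaIndex_le_of_trace_colorGram (hV : Fintype.card V = Fintype.card W)
    (hc : Γ.adjMatrix.IsColoredBy c) (hd : Δ.adjMatrix.IsColoredBy d)
    (h : ∀ k ≠ 0,
      (colorGram Γ.adjMatrix c κ ^ k).trace ≤ (colorGram Δ.adjMatrix d κ' ^ k).trace) :
    Γ.estradaIndex ≤ Δ.estradaIndex :=
  hasSum_le (trace_div_factorial_le hV hc hd h) (Γ.hasSum_estradaIndex_of_isColoredBy hc)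
    (Δ.hasSum_estradaIndex_of_isColoredBy hd)

/-- A strict inequality in a single term of the exponential series would make the sums differ. -/
theorem trace_colorGram_pow_eq_of_estradaIndex_eq (hV : Fintype.card V = Fintype.card W)
    (hc : Γ.adjMatrix.IsColoredBy c) (hd : Δ.adjMatrix.IsColoredBy d)
    (h : ∀ k ≠ 0,
      (colorGram Γ.adjMatrix c κ ^ k).trace ≤ (colorGram Δ.adjMatrix d κ' ^ k).trace)
    (he : Γ.estradaIndex = Δ.estradaIndex) {k : ℕ} (hk : k ≠ 0) :
    (colorGram Γ.adjMatrix c κ ^ k).trace = (colorGram Δ.adjMatrix d κ' ^ k).trace := by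
  refine (h k hk).eq_of_not_lt fun hlt => he.not_lt ?_
  refine hasSum_lt (trace_div_factorial_le hV hc hd h) (i := k) ?_
    (Γ.hasSum_estradaIndex_of_isColoredBy hc) (Δ.hasSum_estradaIndex_of_isColoredBy hd)
  rw [← hc.two_mul_trace_colorGram_pow Γ.adjMatrix_isHermitian κ hk,
    ← hd.two_mul_trace_colorGram_pow Δ.adjMatrix_isHermitian κ' hk]
  gcongr

end estradaIndex

section switching

variable {V W : Type*}

theorem adjMatrix_switch (Γ : SignedGraph V) (Z : Set V) [DecidablePred (· ∈ Z)] (u v : V) :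
    (Γ.switch Z).adjMatrix u v =
      (if u ∈ Z then -1 else 1) * (if v ∈ Z then -1 else 1) * Γ.adjMatrix u v := by
  by_cases h : Γ.graph.Adj u v
  · rw [Γ.adjMatrix_of_adj h, (Γ.switch Z).adjMatrix_of_adj h]
    have key : (∃ a ∈ Z, ∃ b ∉ Z, s(u, v) = s(a, b)) ↔ ¬ (u ∈ Z ↔ v ∈ Z) := by
      simp only [Sym2.eq_iff]
      grind
    simp only [switch, key]
    by_cases hu : u ∈ Z <;> by_cases hv : v ∈ Z <;> simp [hu, hv]
  · rw [Γ.adjMatrix_of_not_adj h, (Γ.switch Z).adjMatrix_of_not_adj h, mul_zero]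

theorem isIsomorphic_iff (Γ : SignedGraph V) (Δ : SignedGraph W) :
    Γ.IsIsomorphic Δ ↔ ∃ f : V ≃ W, ∀ u v, Δ.adjMatrix (f u) (f v) = Γ.adjMatrix u v := by
  constructor
  · rintro ⟨f, hf⟩
    refine ⟨f.toEquiv, fun u v => ?_⟩
    by_cases h : Γ.graph.Adj u v
    · have h' : Δ.graph.Adj (f u) (f v) := f.map_adj_iff.2 h
      have := hf ⟨s(u, v), h⟩
      rw [Γ.adjMatrix_of_adj h, ← this]
      exact Δ.adjMatrix_of_adj h'
    · rw [Γ.adjMatrix_of_not_adj h]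
      exact Δ.adjMatrix_of_not_adj fun h' => h (f.map_adj_iff.1 h')
  · rintro ⟨f, hf⟩
    refine ⟨⟨f, fun {u v} => ?_⟩, ?_⟩
    · rw [← adjMatrix_ne_zero, ← adjMatrix_ne_zero, hf]
    · rintro ⟨e, he⟩
      induction e with | _ u v
      have h' : Δ.graph.Adj (f u) (f v) := by
        rw [← adjMatrix_ne_zero, hf, adjMatrix_ne_zero]
        exact he
      have := hf u v
      rw [Δ.adjMatrix_of_adj h', Γ.adjMatrix_of_adj he] at this
      exact_mod_cast this

/-- Replaces the switching set by its `±1`-valued function, so that switching becomes conjugation by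
a diagonal matrix. -/
theorem switchingEquivalent_iff (Γ : SignedGraph V) (Δ : SignedGraph W) :
    Γ.SwitchingEquivalent Δ ↔ ∃ (f : V ≃ W) (θ : V → ℝ), (∀ v, θ v * θ v = 1) ∧
      ∀ u v, Δ.adjMatrix (f u) (f v) = θ u * θ v * Γ.adjMatrix u v := by
  classical
  simp only [SwitchingEquivalent, isIsomorphic_iff, adjMatrix_switch]
  constructor
  · rintro ⟨Z, f, hf⟩
    exact ⟨f, fun v => if v ∈ Z then -1 else 1, fun v => by dsimp only; split_ifs <;> simp, hf⟩
  · rintro ⟨f, θ, hθ, hf⟩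
    refine ⟨{v | θ v = -1}, f, fun u v => ?_⟩
    have (w : V) : (if w ∈ {v | θ v = -1} then -1 else 1) = θ w := by
      rcases mul_self_eq_one_iff.1 (hθ w) with h | h <;> (simp [h]; try norm_num)
    rw [hf, this, this]

theorem SwitchingEquivalent.estradaIndex_eq [Fintype V] [Fintype W] {Γ : SignedGraph V}
    {Δ : SignedGraph W} (h : Γ.SwitchingEquivalent Δ) : Γ.estradaIndex = Δ.estradaIndex := by
  classical
  obtain ⟨f, θ, hθ, hf⟩ := (switchingEquivalent_iff Γ Δ).1 h
  refine estradaIndex_eq_of_trace_pow _ _ fun k => ?_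
  have : Matrix.reindexAlgEquiv ℝ ℝ f (diagonal θ * Γ.adjMatrix * diagonal θ) = Δ.adjMatrix := by
    ext u v
    have := hf (f.symm u) (f.symm v)
    rw [f.apply_symm_apply, f.apply_symm_apply] at this
    simp only [coe_reindexAlgEquiv, reindex_apply, submatrix_apply, mul_diagonal, diagonal_mul]
    rw [this]
    ring
  rw [← this, ← map_pow, coe_reindexAlgEquiv, ← trace_diagonal_conj_pow _ hθ]
  exact (Equiv.sum_comp f.symm _).symm

end switching

end SignedGraph

/-! ### Connected graphs with as many edges as vertices -/

namespace SimpleGraph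

variable {V : Type*} {G : SimpleGraph V}

/-- In a connected graph every vertex outside of `S` has a neighbour that is closer to `S`. -/
theorem Connected.exists_parent (hG : G.Connected) {S : Set V} (hS : S.Nonempty) :
    ∃ (p : V → V) (ρ : V → ℕ), ∀ v ∉ S, G.Adj v (p v) ∧ ρ v = ρ (p v) + 1 := by
  let ρ : V → ℕ := fun v => sInf (G.dist v '' S)
  have hmem (v : V) : ∃ s ∈ S, G.dist v s = ρ v := Nat.sInf_mem (hS.image (G.dist v))
  have hle {v s : V} (hs : s ∈ S) : ρ v ≤ G.dist v s := Nat.sInf_le ⟨s, hs, rfl⟩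
  have h (v : V) : ∃ w, v ∉ S → G.Adj v w ∧ ρ v = ρ w + 1 := by
    obtain ⟨s, hs, hd⟩ := hmem v
    obtain ⟨q, hq⟩ := hG.exists_walk_length_eq_dist v s
    cases q with
    | nil => exact ⟨v, fun h => absurd hs h⟩
    | @cons _ w _ hvw q =>
      refine ⟨w, fun _ => ⟨hvw, le_antisymm ?_ ?_⟩⟩
      · obtain ⟨t, ht, hdt⟩ := hmem w
        have := hG.dist_triangle (u := v) (v := w) (w := t)
        rw [SimpleGraph.dist_eq_one_iff_adj.2 hvw] at this
        have := hle (v := v) ht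
        omega
      · have h1 := hle (v := w) hs
        have h2 := SimpleGraph.dist_le q
        rw [Walk.length_cons] at hq
        omega
  choose p hp using h
  exact ⟨p, ρ, hp⟩

/-- If two different vertices had the same parent edge, each would be the parent of the other, and
`ρ` would have to decrease both ways. -/
theorem sym2_parent_injOn {S : Set V} {p : V → V} {ρ : V → ℕ}
    (h : ∀ v ∉ S, ρ v = ρ (p v) + 1) : Set.InjOn (fun v => s(v, p v)) Sᶜ := by
  intro u hu v hv huv
  rcases Sym2.eq_iff.1 huv with h1 | h1
  · exact h1.1
  · have h2 := h u hu
    have h3 := h v hv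
    rw [h1.2] at h2
    rw [← h1.1] at h3
    omega

variable [Fintype V]

/-- In a connected graph with as many edges as vertices, a set of vertices spans at most as many
edges as it has elements. -/
theorem Connected.card_le_card_of_edges (hG : G.Connected)
    (hE : G.edgeSet.ncard = Fintype.card V) {S : Finset V} {F : Finset (Sym2 V)}
    (hF : ∀ e ∈ F, e ∈ G.edgeSet) (hFS : ∀ e ∈ F, ∀ v ∈ e, v ∈ S) : F.card ≤ S.card := by
  classical
  rcases F.eq_empty_or_nonempty with rfl | ⟨e, he⟩
  · simp
  have hS : (S : Set V).Nonempty := by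
    induction e with | _ u v
    exact ⟨u, hFS _ he u (by simp)⟩
  obtain ⟨p, ρ, hp⟩ := hG.exists_parent hS
  have hinj := sym2_parent_injOn fun v hv => (hp v hv).2
  have hcard : (Sᶜ.image fun v => s(v, p v)).card = Fintype.card V - S.card := by
    rw [Finset.card_image_of_injOn (by simpa using hinj), Finset.card_compl]
  -- A parent edge has an end outside of `S`. So `F` and the `|V| - |S|` distinct parent edges are
  -- disjoint, and there are only `|V|` edges in all.
  have hdisj : Disjoint F (Sᶜ.image fun v => s(v, p v)) := by
    rw [Finset.disjoint_left]
    intro e he he'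
    obtain ⟨v, hv, rfl⟩ := Finset.mem_image.1 he'
    exact Finset.mem_compl.1 hv (hFS _ he v (by simp))
  have hsub : ((F ∪ Sᶜ.image fun v => s(v, p v) : Finset (Sym2 V)) : Set (Sym2 V)) ⊆
      G.edgeSet := by
    intro e he
    rcases Finset.mem_union.1 (Finset.mem_coe.1 he) with h | h
    · exact hF e h
    · obtain ⟨v, hv, rfl⟩ := Finset.mem_image.1 h
      exact (hp v (by simpa using hv)).1
  have := Set.ncard_le_ncard hsub (Set.toFinite _)
  rw [Set.ncard_coe_finset, Finset.card_union_of_disjoint hdisj, hcard, hE] at this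
  have := S.card_le_univ
  omega

theorem Connected.length_le_length_of_edges (hG : G.Connected)
    (hE : G.edgeSet.ncard = Fintype.card V) {S : List V} {F : List (Sym2 V)} (hn : F.Nodup)
    (hF : ∀ e ∈ F, e ∈ G.edgeSet) (hFS : ∀ e ∈ F, ∀ v ∈ e, v ∈ S) : F.length ≤ S.length := by
  classical
  rw [← List.toFinset_card_of_nodup hn]
  refine (hG.card_le_card_of_edges hE (S := S.toFinset) ?_ ?_).trans S.toFinset_card_le
  · simpa using hF
  · simpa using hFS

theorem Connected.mem_edges_of_isCycle (hG : G.Connected)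
    (hE : G.edgeSet.ncard = Fintype.card V) {w : V} {p : G.Walk w w} (hp : p.IsCycle) {u v : V}
    (hu : u ∈ p.support) (hv : v ∈ p.support) (huv : G.Adj u v) : s(u, v) ∈ p.edges := by
  by_contra h
  have htail (x : V) (hx : x ∈ p.support) : x ∈ p.support.tail := by
    rw [← Walk.cons_tail_support, List.mem_cons] at hx
    rcases hx with rfl | hx
    · exact Walk.end_mem_tail_support hp.not_nil
    · exact hx
  -- The tail of the support lists the start vertex only once, so it is as long as the list of
  -- edges; a chord would be one edge too many.
  have := hG.length_le_length_of_edges hE (S := p.support.tail) (F := s(u, v) :: p.edges)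
    (List.nodup_cons.2 ⟨h, hp.edges_nodup⟩) ?_ ?_
  · rw [List.length_cons, Walk.length_edges, List.length_tail, Walk.length_support] at this
    omega
  · intro e he
    rcases List.mem_cons.1 he with rfl | he
    · exact huv
    · exact p.edges_subset_edgeSet he
  · intro e he x hx
    rcases List.mem_cons.1 he with rfl | he
    · rcases Sym2.mem_iff.1 hx with rfl | rfl
      exacts [htail _ hu, htail _ hv]
    · exact htail _ (Walk.mem_support_of_mem_edges he hx)

/-- The cycle of a connected graph with as many edges as vertices has no chords. -/
theorem Connected.getVert_adj_of_isCycle (hG : G.Connected)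
    (hE : G.edgeSet.ncard = Fintype.card V) {w : V} {p : G.Walk w w} (hp : p.IsCycle) {i j : ℕ}
    (hi : i < p.length) (hj : j < p.length) (h : G.Adj (p.getVert i) (p.getVert j)) :
    j = i + 1 ∨ i = j + 1 ∨ (i = 0 ∧ j + 1 = p.length) ∨ (j = 0 ∧ i + 1 = p.length) := by
  have hmem := hG.mem_edges_of_isCycle hE hp (p.getVert_mem_support i) (p.getVert_mem_support j) h
  have hinj {a b : ℕ} (ha : a < p.length) (hb : b < p.length)
      (hab : p.getVert a = p.getVert b) : a = b :=
    hp.getVert_injOn' (by simp; omega) (by simp; omega) hab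
  rw [Walk.edges, List.mem_map] at hmem
  obtain ⟨d, hd, hde⟩ := hmem
  obtain ⟨k, hk, rfl⟩ := List.getElem_of_mem hd
  rw [Walk.darts_getElem_eq_getVert] at hde
  have hk' : k < p.length := by simpa using hk
  have hsucc {a : ℕ} (ha : a < p.length) (hab : p.getVert a = p.getVert (k + 1)) :
      a = k + 1 ∨ a = 0 ∧ k + 1 = p.length := by
    rcases (Nat.succ_le_of_lt hk').eq_or_lt with h1 | h1
    · refine Or.inr ⟨hinj ha (by omega) ?_, h1⟩
      rw [hab, p.getVert_zero, show k + 1 = p.length from h1, p.getVert_length]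
    · exact Or.inl (hinj ha h1 hab)
  rcases Sym2.eq_iff.1 hde with ⟨h1, h2⟩ | ⟨h1, h2⟩
  · have e1 := hinj hk' hi h1
    have e2 := hsucc hj h2.symm
    omega
  · have e1 := hinj hk' hj h1
    have e2 := hsucc hi h2.symm
    omega

/-- The edges of a connected graph with as many edges as vertices are, up to one of them, the edges
of a spanning tree, on which every `±1`-valued function has a potential. -/
theorem Connected.exists_potential (hG : G.Connected)
    (hE : G.edgeSet.ncard = Fintype.card V) :
    ∃ e₀ ∈ G.edgeSet, ∀ h : V → V → ℝ, (∀ u v, h u v = h v u) →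
      (∀ u v, G.Adj u v → h u v * h u v = 1) →
      ∃ θ : V → ℝ, (∀ v, θ v * θ v = 1) ∧
        ∀ u v, G.Adj u v → s(u, v) ≠ e₀ → h u v = θ u * θ v := by
  classical
  obtain ⟨r⟩ := hG.nonempty
  obtain ⟨p, ρ, hp⟩ := hG.exists_parent (Set.singleton_nonempty r)
  have hinj := sym2_parent_injOn fun v hv => (hp v hv).2
  set T : Finset (Sym2 V) := ({r}ᶜ : Finset V).image fun v => s(v, p v) with hT
  have hcard : T.card + 1 = Fintype.card V := by
    have : 0 < Fintype.card V := Fintype.card_pos_iff.2 ⟨r⟩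
    rw [Finset.card_image_of_injOn (by simpa using hinj), Finset.card_compl,
      Finset.card_singleton]
    omega
  have hTE : ∀ e ∈ T, e ∈ G.edgeSet := by
    intro e he
    obtain ⟨v, hv, rfl⟩ := Finset.mem_image.1 he
    exact (hp v (by simpa using hv)).1
  have hfin : G.edgeSet.Finite := Set.toFinite _
  rw [Set.ncard_eq_toFinset_card _ hfin] at hE
  obtain ⟨e₀, he₀, he₀T⟩ : ∃ e₀ ∈ hfin.toFinset, e₀ ∉ T := by
    apply Finset.exists_mem_notMem_of_card_lt_card
    omega
  have hET : insert e₀ T = hfin.toFinset := by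
    refine Finset.eq_of_subset_of_card_le (Finset.insert_subset he₀ fun e he => ?_) ?_
    · simpa using hTE e he
    · rw [Finset.card_insert_of_notMem he₀T, hcard, hE]
  -- The edge `e₀` is chosen before `h`, so that potentials of several functions can be compared on
  -- the same tree.
  refine ⟨e₀, by simpa using he₀, fun h hsymm h1 => ?_⟩
  -- The sign of the parent edge. The value at the root only has to be a unit: `ρ r` is not known to
  -- be 0, so the iterates of `p` may run past `r`.
  let f : V → ℝ := fun v => if v = r then 1 else h v (p v)
  have hf (v : V) : f v * f v = 1 := by
    by_cases hv : v = r
    · simp [f, hv]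
    · simpa [f, hv] using h1 _ _ (hp v hv).1
  refine ⟨fun v => ∏ i ∈ Finset.range (ρ v), f (p^[i] v), fun v => ?_, ?_⟩
  · rw [← Finset.prod_mul_distrib]
    exact Finset.prod_eq_one fun i _ => hf _
  -- The products for `v` and for `p v` share all factors but `f v`, and the shared factors square
  -- to 1.
  have key (v : V) (hv : v ≠ r) : h v (p v) = (∏ i ∈ Finset.range (ρ v), f (p^[i] v)) *
      ∏ i ∈ Finset.range (ρ (p v)), f (p^[i] (p v)) := by
    rw [(hp v hv).2, Finset.prod_range_succ']
    simp only [Function.iterate_succ_apply, Function.iterate_zero, id_eq]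
    rw [mul_right_comm, ← Finset.prod_mul_distrib, Finset.prod_eq_one fun i _ => hf _, one_mul]
    simp [f, hv]
  intro u v huv hne
  have hmem : s(u, v) ∈ T := by
    have : s(u, v) ∈ insert e₀ T := by rw [hET]; simpa using huv
    exact (Finset.mem_insert.1 this).resolve_left hne
  obtain ⟨x, hx, hxe⟩ := Finset.mem_image.1 hmem
  have hxr : x ≠ r := by simpa using hx
  rcases Sym2.eq_iff.1 hxe with ⟨rfl, rfl⟩ | ⟨rfl, rfl⟩
  · exact key _ hxr
  · rw [hsymm, mul_comm]
    exact key _ hxr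

end SimpleGraph

/-! ### The pairing property of unicyclic signed graphs -/

namespace SignedGraph

variable {V : Type*}

theorem walkSign_eq_prod (Γ : SignedGraph V) {u v : V} (p : Γ.graph.Walk u v) :
    ((Γ.walkSign p : ℤ) : ℝ) =
      ∏ i ∈ Finset.range p.length, Γ.adjMatrix (p.getVert i) (p.getVert (i + 1)) := by
  induction p with
  | nil => simp [walkSign]
  | @cons u v w h q ih =>
    rw [SimpleGraph.Walk.length_cons, Finset.prod_range_succ']
    simp only [SimpleGraph.Walk.getVert_cons_succ, SimpleGraph.Walk.getVert_zero]
    rw [← ih, Γ.adjMatrix_of_adj h, mul_comm]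
    simp [walkSign, SimpleGraph.Dart.edge]

/-- A nonbipartite connected signed graph with as many edges as vertices is, up to switching and up
to the sign of the adjacency matrix, an unsigned graph. -/
theorem IsUnicyclic.exists_switching [Fintype V] {Γ : SignedGraph V} (h : Γ.IsUnicyclic)
    (hb : ¬ Γ.graph.IsBipartite) :
    ∃ (ε : ℝ) (θ : V → ℝ), ε * ε = 1 ∧ (∀ v, θ v * θ v = 1) ∧
      ∀ u v, Γ.graph.Adj u v → Γ.adjMatrix u v = ε * (θ u * θ v) := by
  obtain ⟨e₀, he₀, hpot⟩ := h.1.exists_potential h.2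
  obtain ⟨θ, hθ, hθe⟩ := hpot Γ.adjMatrix Γ.adjMatrix_comm fun u v huv => Γ.adjMatrix_mul_self huv
  obtain ⟨η, hη, hηe⟩ := hpot (fun _ _ => -1) (fun _ _ => rfl) fun _ _ _ => by norm_num
  induction e₀ with | _ x y
  have hxy : Γ.graph.Adj x y := he₀
  -- The potential `η` of the constant `-1` is a 2-colouring of the tree. If it also separated the
  -- ends of `e₀`, the whole graph would be bipartite.
  have hsame : η x * η y = 1 := by
    have h1 : (η x * η y) * (η x * η y) = 1 := by
      rw [mul_mul_mul_comm, hη, hη, one_mul]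
    refine (mul_self_eq_one_iff.1 h1).resolve_right fun h2 => hb ?_
    classical
    refine ⟨SimpleGraph.Coloring.mk (fun v => if η v = 1 then (0 : Fin 2) else 1) fun {u v} huv heq => ?_⟩
    have h3 : η u * η v = -1 := by
      by_cases he : s(u, v) = s(x, y)
      · rcases Sym2.eq_iff.1 he with ⟨rfl, rfl⟩ | ⟨rfl, rfl⟩
        · exact h2
        · rw [mul_comm]; exact h2
      · exact (hηe u v huv he).symm
    rcases mul_self_eq_one_iff.1 (hη u) with hu | hu <;>
      rcases mul_self_eq_one_iff.1 (hη v) with hv | hv <;> rw [hu, hv] at h3 heq <;>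
      norm_num at h3
    · rw [if_pos rfl, if_neg (by norm_num)] at heq
      exact absurd heq (by decide)
    · rw [if_pos rfl, if_neg (by norm_num)] at heq
      exact absurd heq (by decide)
  have hcases : Γ.adjMatrix x y = θ x * θ y ∨ Γ.adjMatrix x y = -(θ x * θ y) := by
    refine mul_self_eq_mul_self_iff.1 ?_
    rw [Γ.adjMatrix_mul_self hxy, mul_mul_mul_comm, hθ, hθ, one_mul]
  rcases hcases with hs | hs
  · refine ⟨1, θ, by norm_num, hθ, fun u v huv => ?_⟩
    rw [one_mul]
    by_cases he : s(u, v) = s(x, y)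
    · rcases Sym2.eq_iff.1 he with ⟨rfl, rfl⟩ | ⟨rfl, rfl⟩
      · exact hs
      · rw [Γ.adjMatrix_comm, mul_comm]; exact hs
    · exact hθe u v huv he
  -- Here `θ` gives the wrong sign on `e₀` only. The factor `-(η u * η v)` is 1 on the tree and `-1`
  -- on `e₀`, which corrects this.
  · refine ⟨-1, fun v => θ v * η v, by norm_num, fun v => ?_, fun u v huv => ?_⟩
    · rw [mul_mul_mul_comm, hθ, hη, one_mul]
    · rw [mul_mul_mul_comm]
      by_cases he : s(u, v) = s(x, y)
      · rcases Sym2.eq_iff.1 he with ⟨rfl, rfl⟩ | ⟨rfl, rfl⟩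
        · rw [hs, hsame]; ring
        · rw [Γ.adjMatrix_comm, hs, mul_comm (η u), hsame]; ring
      · rw [← hηe u v huv he, hθe u v huv he]; ring

theorem PairingProperty.trace_pow_odd [Fintype V] [DecidableEq V] {Γ : SignedGraph V}
    (h : Γ.PairingProperty) {k : ℕ} (hk : Odd k) : (Γ.adjMatrix ^ k).trace = 0 := by
  have e : ‹DecidableEq V› = fun a b => Classical.propDecidable (a = b) := Subsingleton.elim _ _
  subst e
  classical
  have hr : Γ.adjMatrix.charpoly.roots.map Neg.neg = Γ.adjMatrix.charpoly.roots := by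
    ext μ
    have h1 := Multiset.count_map_eq_count' Neg.neg Γ.adjMatrix.charpoly.roots neg_injective (-μ)
    rw [neg_neg, Polynomial.count_roots] at h1
    rw [h1, Polynomial.count_roots]
    exact h μ
  have hs : (Γ.adjMatrix ^ k).trace = (Γ.adjMatrix.charpoly.roots.map (· ^ k)).sum := by
    rw [Γ.adjMatrix_isHermitian.trace_pow_eq_sum_eigenvalues_pow,
      Γ.adjMatrix_isHermitian.roots_charpoly_eq_eigenvalues, Multiset.map_map]
    rfl
  have hs' : (Γ.adjMatrix.charpoly.roots.map (· ^ k)).sum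
      = -(Γ.adjMatrix.charpoly.roots.map (· ^ k)).sum := by
    conv_lhs => rw [← hr, Multiset.map_map]
    simp only [Function.comp_def, hk.neg_pow]
    exact Multiset.sum_map_neg
  rw [hs]
  linarith

/-- Up to sign and conjugation, `A` is the unsigned adjacency matrix, whose powers count walks. A
closed walk of odd length would give an odd power a nonzero trace. -/
theorem PairingProperty.isBipartite [Fintype V] {Γ : SignedGraph V} (hu : Γ.IsUnicyclic)
    (h : Γ.PairingProperty) : Γ.graph.IsBipartite := by
  classical
  by_contra hb
  obtain ⟨ε, θ, hε, hθ, hA⟩ := hu.exists_switching hb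
  have hA' : Γ.adjMatrix = ε • (diagonal θ * Γ.graph.adjMatrix ℝ * diagonal θ) := by
    ext u v
    rw [Matrix.smul_apply, mul_diagonal, diagonal_mul, SimpleGraph.adjMatrix_apply, smul_eq_mul]
    split_ifs with huv
    · rw [hA u v huv, mul_one]
    · rw [Γ.adjMatrix_of_not_adj huv]; ring
  refine hb (SimpleGraph.two_colorable_iff_forall_loop_even.2 fun v w => ?_)
  by_contra hodd
  rw [Nat.not_even_iff_odd] at hodd
  have ht := h.trace_pow_odd hodd
  rw [hA', smul_pow, trace_smul, trace_diagonal_conj_pow _ hθ, smul_eq_mul] at ht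
  have hε0 : ε ≠ 0 := fun h0 => by simp [h0] at hε
  have ht' := (mul_eq_zero.1 ht).resolve_left (pow_ne_zero _ hε0)
  have hnn (x : V) : 0 ≤ (Γ.graph.adjMatrix ℝ ^ w.length) x x := by
    rw [SimpleGraph.adjMatrix_pow_apply_eq_card_walk]
    positivity
  have hz := (Finset.sum_eq_zero_iff_of_nonneg fun x _ => hnn x).1 ht' v (Finset.mem_univ v)
  rw [SimpleGraph.adjMatrix_pow_apply_eq_card_walk, Nat.cast_eq_zero,
    Fintype.card_eq_zero_iff] at hz
  exact hz.elim ⟨w, rfl⟩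

/-- `A` and `-A` are conjugate, so the multiset of roots of the characteristic polynomial is stable
under negation. -/
theorem pairingProperty_of_isBipartite [Fintype V] {Γ : SignedGraph V}
    (h : Γ.graph.IsBipartite) : Γ.PairingProperty := by
  classical
  obtain ⟨c, hc⟩ := Γ.exists_isColoredBy h
  have h1 := charpoly_diagonal_conj Γ.adjMatrix (θ := fun v => if c v then 1 else -1)
    (fun v => by split_ifs <;> simp)
  rw [hc.neg_eq, Γ.adjMatrix_isHermitian.charpoly_neg_eq] at h1
  have hroots : Γ.adjMatrix.charpoly.roots.map Neg.neg = Γ.adjMatrix.charpoly.roots := by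
    conv_rhs => rw [← h1, Polynomial.roots_prod _ _
      (by simp [Finset.prod_ne_zero_iff, Polynomial.X_sub_C_ne_zero, -map_neg])]
    rw [Γ.adjMatrix_isHermitian.roots_charpoly_eq_eigenvalues, Multiset.map_map]
    simp only [Polynomial.roots_X_sub_C, Multiset.bind_singleton]
    rfl
  intro μ
  have h2 := Multiset.count_map_eq_count' Neg.neg Γ.adjMatrix.charpoly.roots neg_injective μ
  rw [hroots, Polynomial.count_roots, Polynomial.count_roots] at h2
  exact h2

end SignedGraph

/-! ### Test vectors for the Gram matrices -/

namespace Matrix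

variable {V : Type*} [Fintype V] [DecidableEq V] {A : Matrix V V ℝ} {c : V → Bool} {κ : Bool}

/-- The linear map that places a coefficient vector on the vertices `a i`. -/
noncomputable def vertexComb {m : ℕ} (a : Fin m → V) : (Fin m → ℝ) →ₗ[ℝ] (V → ℝ) :=
  Fintype.linearCombination ℝ fun i => (Pi.single (a i) 1 : V → ℝ)

theorem vertexComb_dotProduct {m : ℕ} (a : Fin m → V) (r : Fin m → ℝ) (x : V → ℝ) :
    vertexComb a r ⬝ᵥ x =
      ∑ i, r i * x (a i) := by
  simp [vertexComb, Fintype.linearCombination_apply, sum_dotProduct, smul_dotProduct]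

theorem vertexComb_apply {V : Type*} [DecidableEq V] {m : ℕ} {a : Fin m → V} (ha : Function.Injective a)
    (r : Fin m → ℝ) (i : Fin m) :
    vertexComb a r (a i) = r i := by
  simp [vertexComb, Fintype.linearCombination_apply, Finset.sum_apply, Pi.single_apply, ha.eq_iff]

theorem vertexComb_apply_eq_zero {V : Type*} [DecidableEq V] {c : V → Bool} {κ : Bool} {m : ℕ}
    {a : Fin m → V} (hκ : ∀ i, c (a i) = κ)
    (r : Fin m → ℝ) {v : V} (hv : c v ≠ κ) :
    vertexComb a r v = 0 := by
  have (i : Fin m) : v ≠ a i := fun h => hv (h ▸ hκ i)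
  simp [vertexComb, Fintype.linearCombination_apply, Finset.sum_apply, this]

theorem mulVec_vertexComb {m : ℕ} (a : Fin m → V) (r : Fin m → ℝ) (u : V) :
    (A *ᵥ vertexComb a r) u =
      ∑ i, A u (a i) * r i := by
  rw [mulVec, dotProduct_comm, vertexComb_dotProduct]
  exact Finset.sum_congr rfl fun i _ => mul_comm _ _

/-- A lower bound for the eigenvalues of the Gram matrix from a space of vectors that are supported
on the vertices `a i`. -/
theorem exists_le_eigenvalue_colorGram {m k : ℕ} {a : Fin m → V} (ha : Function.Injective a)
    (hκ : ∀ i, c (a i) = κ) (M : (Fin k → ℝ) →ₗ[ℝ] (Fin m → ℝ)) (hM : Function.Injective M)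
    {T : Finset V} (hT : T.card < k) (C : ℝ)
    (h : ∀ t, C * ∑ i, M t i ^ 2 ≤ ∑ u, (∑ i, A u (a i) * M t i) ^ 2) :
    ∃ j ∉ T, C ≤ (colorGram_posSemidef A c κ).1.eigenvalues j := by
  refine (colorGram_posSemidef A c κ).1.exists_le_eigenvalue T hT
    ((vertexComb a ∘ₗ M)) ?_ C fun t => ?_
  · rw [LinearMap.coe_comp]
    refine Function.Injective.comp (fun r s hrs => funext fun i => ?_) hM
    rw [← vertexComb_apply ha r, hrs, vertexComb_apply ha]
  · rw [LinearMap.comp_apply, dotProduct_colorGram_mulVec A c κ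
      fun v hv => vertexComb_apply_eq_zero hκ (M t) hv,
      vertexComb_dotProduct]
    simp only [vertexComb_apply ha, dotProduct, mulVec_vertexComb,
      ← pow_two]
    exact h t

/-- On vectors supported in the colour class the quadratic form is `‖A x‖²`, so linearly independent
columns make it positive definite on their span. It serves to bound the rank from below. -/
theorem exists_eigenvalue_colorGram_pos {m : ℕ} {a : Fin m → V}
    (hκ : ∀ i, c (a i) = κ) {T : Finset V} (hT : T.card < m)
    (h : ∀ r : Fin m → ℝ, (∀ u, ∑ i, A u (a i) * r i = 0) → r = 0) :
    ∃ j ∉ T, 0 < (colorGram_posSemidef A c κ).1.eigenvalues j := by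
  refine (colorGram_posSemidef A c κ).1.exists_eigenvalue_pos T hT
    (vertexComb a) fun r hr => ?_
  rw [dotProduct_colorGram_mulVec A c κ
    fun v hv => vertexComb_apply_eq_zero hκ r hv]
  refine lt_of_le_of_ne ?_ fun h0 => hr (h r fun u => ?_)
  · simpa [dotProduct] using Finset.sum_nonneg fun i _ => mul_self_nonneg _
  · rw [← mulVec_vertexComb, dotProduct_self_eq_zero.1 h0.symm, Pi.zero_apply]

/-- For lower bounds on `‖A x‖²` a few well-chosen rows suffice. -/
theorem sum_sq_comp_le {V : Type*} [Fintype V] {l : ℕ} {u : Fin l → V} (hu : Function.Injective u) (f : V → ℝ) :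
    ∑ i, f (u i) ^ 2 ≤ ∑ v, f v ^ 2 := by
  refine (Finset.sum_map Finset.univ ⟨u, hu⟩ fun v => f v ^ 2).symm.trans_le ?_
  exact Finset.sum_le_sum_of_subset_of_nonneg (Finset.subset_univ _) fun v _ _ => sq_nonneg _

theorem IsColoredBy.eq_not {V : Type*} {A : Matrix V V ℝ} {c : V → Bool} (hc : IsColoredBy A c) {u v : V} (h : A u v ≠ 0) : c v = !c u := by
  have := hc u v h
  cases hu : c u <;> cases hv : c v <;> simp_all

end Matrix

/-! ### Gram eigenvalues forced by a negative cycle -/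

namespace SignedGraph

variable {V : Type*} {Γ : SignedGraph V}

/-- A chordless negative cycle of length `g`, traversed periodically. -/
structure IsNegCycle (Γ : SignedGraph V) (g : ℕ) (b : ℕ → V) : Prop where
  periodic : ∀ i, b (i + g) = b i
  inj : ∀ {i j}, b i = b j → i ≡ j [MOD g]
  adj : ∀ i, Γ.graph.Adj (b i) (b (i + 1))
  chordless : ∀ {i j}, Γ.graph.Adj (b i) (b j) → i + 1 ≡ j [MOD g] ∨ j + 1 ≡ i [MOD g]
  prod_eq : ∏ i ∈ Finset.range g, Γ.adjMatrix (b i) (b (i + 1)) = -1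

theorem IsNegCycle.shift {g : ℕ} {b : ℕ → V} (h : Γ.IsNegCycle g b) :
    Γ.IsNegCycle g fun i => b (i + 1) where
  periodic i := by rw [add_right_comm]; exact h.periodic _
  inj hij := Nat.ModEq.add_right_cancel' 1 (h.inj hij)
  adj i := h.adj _
  chordless hij := (h.chordless hij).imp (fun e => Nat.ModEq.add_right_cancel' 1 e)
    fun e => Nat.ModEq.add_right_cancel' 1 e
  prod_eq := by
    have h1 := Finset.prod_range_succ (fun i => Γ.adjMatrix (b i) (b (i + 1))) g
    rw [Finset.prod_range_succ', h.prod_eq, show g + 1 = 1 + g from add_comm _ _, h.periodic,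
      ← zero_add g, h.periodic, zero_add, zero_add] at h1
    refine mul_right_cancel₀ (Γ.adjMatrix_ne_zero.2 (h.adj 0)) (h1.trans ?_)
    rfl

theorem exists_isNegCycle [Fintype V] (h : Γ.IsUnicyclic) (hb : ¬ Γ.IsBalanced) :
    ∃ g ≥ 3, ∃ b, Γ.IsNegCycle g b := by
  simp only [IsBalanced, not_forall] at hb
  obtain ⟨v, p, hp, hs⟩ := hb
  have hg := hp.three_le_length
  have hpos : 0 < p.length := by omega
  have hlt (i : ℕ) : i % p.length < p.length := Nat.mod_lt _ hpos
  have hinj {a b : ℕ} (ha : a < p.length) (hb : b < p.length)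
      (hab : p.getVert a = p.getVert b) : a = b :=
    hp.getVert_injOn' (by simp; omega) (by simp; omega) hab
  -- At `i + 1 = p.length` the closed walk is back at index 0.
  have hsucc {i : ℕ} (hi : i < p.length) : p.getVert ((i + 1) % p.length) = p.getVert (i + 1) := by
    rcases (show i + 1 ≤ p.length from hi).eq_or_lt with h1 | h1
    · rw [h1, Nat.mod_self, p.getVert_zero, p.getVert_length]
    · rw [Nat.mod_eq_of_lt h1]
  refine ⟨p.length, hg, fun i => p.getVert (i % p.length), fun i => by simp,
    fun hij => hinj (hlt _) (hlt _) hij, fun i => ?_, fun {i j} hij => ?_, ?_⟩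
  · rw [← Nat.mod_add_mod, hsucc (hlt i)]
    exact p.adj_getVert_succ (hlt i)
  · have hij' := h.1.getVert_adj_of_isCycle h.2 hp (hlt i) (hlt j) hij
    rw [Nat.ModEq, Nat.ModEq, ← Nat.mod_add_mod, ← Nat.mod_add_mod j]
    rcases hij' with e | e | ⟨e1, e2⟩ | ⟨e1, e2⟩
    · left; rw [← e, Nat.mod_mod]
    · right; rw [← e, Nat.mod_mod]
    · right; rw [e1, e2, Nat.mod_self]
    · left; rw [e1, e2, Nat.mod_self]
  · have h1 : Γ.walkSign p = -1 := (Int.units_eq_one_or _).resolve_left hs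
    have h2 := Γ.walkSign_eq_prod p
    rw [h1] at h2
    rw [← show ((((-1 : ℤˣ) : ℤ)) : ℝ) = -1 by simp, h2]
    refine Finset.prod_congr rfl fun i hi => ?_
    have hi' := Finset.mem_range.1 hi
    rw [hsucc hi', Nat.mod_eq_of_lt hi']

theorem IsNegCycle.color [Fintype V] [DecidableEq V] {g : ℕ} {b : ℕ → V} (h : Γ.IsNegCycle g b)
    {c : V → Bool} (hc : Γ.adjMatrix.IsColoredBy c) (i : ℕ) : c (b (i + 1)) = !c (b i) :=
  hc.eq_not (Γ.adjMatrix_ne_zero.2 (h.adj i))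

theorem IsNegCycle.even [Fintype V] [DecidableEq V] {g : ℕ} {b : ℕ → V} (h : Γ.IsNegCycle g b)
    {c : V → Bool} (hc : Γ.adjMatrix.IsColoredBy c) : Even g := by
  have key (i : ℕ) : c (b i) = if Even i then c (b 0) else !c (b 0) := by
    induction i with
    | zero => simp
    | succ i ih =>
      rw [h.color hc, ih]
      by_cases hi : Even i <;> simp [hi, Nat.even_add_one]
  by_contra hg
  have h1 := key g
  rw [if_neg hg, ← zero_add g, h.periodic] at h1
  cases hb : c (b 0) <;> rw [hb] at h1 <;> exact absurd h1 (by decide)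

theorem IsNegCycle.ne {g : ℕ} {b : ℕ → V} (h : Γ.IsNegCycle g b) {i j : ℕ} (hi : i < g)
    (hj : j < g) (hij : i ≠ j) : b i ≠ b j :=
  fun e => hij ((h.inj e).eq_of_lt_of_lt hi hj)

theorem IsNegCycle.injective_comp {g : ℕ} {b : ℕ → V} (h : Γ.IsNegCycle g b) {m : ℕ} {f : Fin m → ℕ}
    (hf : Function.Injective f) (hlt : ∀ i, f i < g) : Function.Injective fun i => b (f i) := by
  intro i j hij
  by_contra hne
  exact h.ne (hlt i) (hlt j) (hf.ne hne) hij

theorem IsNegCycle.adjMatrix_eq_zero {g : ℕ} {b : ℕ → V} (h : Γ.IsNegCycle g b) {i j : ℕ}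
    (hi : i + 1 < g) (hj : j + 1 < g) (h1 : i + 1 ≠ j) (h2 : j + 1 ≠ i) :
    Γ.adjMatrix (b i) (b j) = 0 := by
  refine Γ.adjMatrix_of_not_adj fun hij => ?_
  rcases h.chordless hij with e | e
  · exact h1 (e.eq_of_lt_of_lt hi (by omega))
  · exact h2 (e.eq_of_lt_of_lt hj (by omega))

theorem IsNegCycle.sq_eq {g : ℕ} {b : ℕ → V} (h : Γ.IsNegCycle g b) (i : ℕ) :
    Γ.adjMatrix (b i) (b (i + 1)) ^ 2 = 1 := by
  rw [pow_two, Γ.adjMatrix_mul_self (h.adj i)]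

section eigenvalues

variable [Fintype V] [DecidableEq V] {c : V → Bool} {κ : Bool} {b : ℕ → V}

/-- The eigenvalues of the Gram matrix of a colour class of a signed graph. -/
noncomputable def gramEigenvalues (Γ : SignedGraph V) (c : V → Bool) (κ : Bool) : V → ℝ :=
  (colorGram_posSemidef Γ.adjMatrix c κ).1.eigenvalues

/-- The rows `b 0, b 2` and columns `b 1, b 3` form a `2 × 2` sign matrix with entry product `-1`.
Its columns are orthogonal of squared length 2. -/
theorem IsNegCycle.exists_two_le_of_four (h : Γ.IsNegCycle 4 b) (hc : Γ.adjMatrix.IsColoredBy c)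
    (hκ : c (b 1) = κ) (i : V) : ∃ j ≠ i, 2 ≤ Γ.gramEigenvalues c κ j := by
  have h3 : c (b 3) = κ := by rw [h.color hc 2, h.color hc 1, Bool.not_not, hκ]
  obtain ⟨j, hj, hj2⟩ := exists_le_eigenvalue_colorGram (A := Γ.adjMatrix) (c := c) (κ := κ)
    (a := fun i => b (![1, 3] i)) (T := {i})
    (h.injective_comp (by decide) (by decide)) (by simp [Fin.forall_fin_two, hκ, h3])
    LinearMap.id Function.injective_id (by simp) 2 fun t => by
      refine le_trans (le_of_eq ?_)
        (sum_sq_comp_le (h.injective_comp (f := ![0, 2]) (by decide) (by decide)) _)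
      have s0 := h.sq_eq 0
      have s1 := h.sq_eq 1
      have s2 := h.sq_eq 2
      have s3 := h.sq_eq 3
      have hp := h.prod_eq
      simp only [Finset.prod_range_succ, Finset.prod_range_zero] at hp
      have e4 : b (3 + 1) = b 0 := h.periodic 0
      rw [e4] at s3 hp
      rw [Γ.adjMatrix_comm (b 3)] at s3 hp
      rw [Γ.adjMatrix_comm (b 1)] at s1 hp
      simp [Fin.sum_univ_two] at *
      generalize Γ.adjMatrix (b 0) (b 1) = x at *
      generalize Γ.adjMatrix (b 0) (b 3) = y at *
      generalize Γ.adjMatrix (b 2) (b 1) = z at *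
      generalize Γ.adjMatrix (b 2) (b 3) = w at *
      rcases s0 with rfl | rfl <;> rcases s1 with rfl | rfl <;> rcases s2 with rfl | rfl <;>
        rcases s3 with rfl | rfl <;> first | (exfalso; linarith) | ring
  exact ⟨j, by simpa using hj, hj2⟩

/-- The Gram matrix of the columns `b 1, b 3, b 5` in the rows `b 0, b 2, b 4` is `2 + S`, where `S`
is the adjacency matrix of a negative triangle. The eigenvalues of `S` are `1, 1, -2`, so 3 is a
double eigenvalue of `2 + S`. -/
theorem IsNegCycle.exists_three_le_of_six (h : Γ.IsNegCycle 6 b) (hc : Γ.adjMatrix.IsColoredBy c)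
    (hκ : c (b 1) = κ) (i : V) : ∃ j ≠ i, 3 ≤ Γ.gramEigenvalues c κ j := by
  have h3 : c (b 3) = κ := by rw [h.color hc 2, h.color hc 1, Bool.not_not, hκ]
  have h5 : c (b 5) = κ := by rw [h.color hc 4, h.color hc 3, Bool.not_not, h3]
  set α := Γ.adjMatrix (b 1) (b 2) * Γ.adjMatrix (b 2) (b 3)
  set γ := Γ.adjMatrix (b 0) (b 1) * Γ.adjMatrix (b 5) (b 0)
  obtain ⟨j, hj, hj2⟩ := exists_le_eigenvalue_colorGram (A := Γ.adjMatrix) (c := c) (κ := κ)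
    (a := fun i => b (![1, 3, 5] i)) (T := {i})
    (h.injective_comp (by decide) (by decide)) (by simp [Fin.forall_fin_succ, hκ, h3, h5])
    -- `S - 1 = -u uᵀ` with `u = (1, -α, -γ)`, so the eigenspace is the plane `x₁ = α x₃ + γ x₅`.
    (Matrix.mulVecLin !![α, γ; 1, 0; 0, 1])
    (by
      intro s t hst
      have e1 := congrFun hst 1
      have e2 := congrFun hst 2
      simp [Matrix.mulVec, dotProduct, Fin.sum_univ_two] at e1 e2
      ext i
      fin_cases i
      exacts [e1, e2]) (by simp) 3 fun t => by
      refine le_trans (le_of_eq ?_)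
        (sum_sq_comp_le (h.injective_comp (f := ![0, 2, 4]) (by decide) (by decide)) _)
      have hz {i j : ℕ} (hij : ¬ (i + 1 ≡ j [MOD 6] ∨ j + 1 ≡ i [MOD 6])) :
          Γ.adjMatrix (b i) (b j) = 0 := Γ.adjMatrix_of_not_adj fun e => hij (h.chordless e)
      have z03 := hz (i := 0) (j := 3) (by decide)
      have z25 := hz (i := 2) (j := 5) (by decide)
      have z41 := hz (i := 4) (j := 1) (by decide)
      have s0 := h.sq_eq 0
      have s1 := h.sq_eq 1
      have s2 := h.sq_eq 2
      have s3 := h.sq_eq 3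
      have s4 := h.sq_eq 4
      have s5 := h.sq_eq 5
      have hp := h.prod_eq
      simp only [Finset.prod_range_succ, Finset.prod_range_zero] at hp
      have e6 : b (5 + 1) = b 0 := h.periodic 0
      rw [e6] at s5 hp
      simp [Fin.sum_univ_succ, Matrix.mulVec, dotProduct, z03, z25, z41, α, γ,
        Γ.adjMatrix_comm (b 2) (b 1), Γ.adjMatrix_comm (b 0) (b 5),
        Γ.adjMatrix_comm (b 4) (b 3)] at *
      generalize Γ.adjMatrix (b 0) (b 1) = x0 at *
      generalize Γ.adjMatrix (b 1) (b 2) = x1 at *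
      generalize Γ.adjMatrix (b 2) (b 3) = x2 at *
      generalize Γ.adjMatrix (b 3) (b 4) = x3 at *
      generalize Γ.adjMatrix (b 4) (b 5) = x4 at *
      generalize Γ.adjMatrix (b 5) (b 0) = x5 at *
      rcases s0 with rfl | rfl <;> rcases s1 with rfl | rfl <;> rcases s2 with rfl | rfl <;>
        rcases s3 with rfl | rfl <;> rcases s4 with rfl | rfl <;> rcases s5 with rfl | rfl <;>
        first | (exfalso; linarith) | ring
  exact ⟨j, by simpa using hj, hj2⟩

/-- On a cycle this long, `b 1` and `b 5` have no common neighbour among the four rows used, so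
their columns there are orthogonal of squared length 2. -/
theorem IsNegCycle.exists_two_le_of_eight_le {g : ℕ} (h : Γ.IsNegCycle g b) (hg : 8 ≤ g)
    (hc : Γ.adjMatrix.IsColoredBy c) (hκ : c (b 1) = κ) (i : V) :
    ∃ j ≠ i, 2 ≤ Γ.gramEigenvalues c κ j := by
  have h3 : c (b 3) = κ := by rw [h.color hc 2, h.color hc 1, Bool.not_not, hκ]
  have h5 : c (b 5) = κ := by rw [h.color hc 4, h.color hc 3, Bool.not_not, h3]
  obtain ⟨j, hj, hj2⟩ := exists_le_eigenvalue_colorGram (A := Γ.adjMatrix) (c := c) (κ := κ)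
    (a := fun i => b (![1, 5] i)) (T := {i})
    (h.injective_comp (by decide) (by simp [Fin.forall_fin_two]; omega))
    (by simp [Fin.forall_fin_two, hκ, h5])
    LinearMap.id Function.injective_id (by simp) 2 fun t => by
      refine le_trans (le_of_eq ?_)
        (sum_sq_comp_le (h.injective_comp (f := ![0, 2, 4, 6]) (by decide)
          (by simp [Fin.forall_fin_succ]; omega)) _)
      have z05 := h.adjMatrix_eq_zero (i := 0) (j := 5) (by omega) (by omega) (by simp) (by simp)
      have z25 := h.adjMatrix_eq_zero (i := 2) (j := 5) (by omega) (by omega) (by simp) (by simp)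
      have z41 := h.adjMatrix_eq_zero (i := 4) (j := 1) (by omega) (by omega) (by simp) (by simp)
      have z61 := h.adjMatrix_eq_zero (i := 6) (j := 1) (by omega) (by omega) (by simp) (by simp)
      have s0 := h.sq_eq 0
      have s1 := h.sq_eq 1
      have s4 := h.sq_eq 4
      have s5 := h.sq_eq 5
      simp only [Nat.reduceAdd, zero_add] at s0 s1 s4 s5
      simp [Fin.sum_univ_succ, z05, z25, z41, z61, mul_pow,
        Γ.adjMatrix_comm (b 2) (b 1), Γ.adjMatrix_comm (b 6) (b 5), s0, s1, s4, s5]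
      ring
  exact ⟨j, by simpa using hj, hj2⟩

/-- The columns `b 1, b 3, b 5` are independent: among them, row `b 0` meets only `b 1`, row `b 6`
only `b 5`, and row `b 2` then isolates `b 3`. -/
theorem IsNegCycle.exists_pos_of_eight_le {g : ℕ} (h : Γ.IsNegCycle g b) (hg : 8 ≤ g)
    (hc : Γ.adjMatrix.IsColoredBy c) (hκ : c (b 1) = κ) {T : Finset V} (hT : T.card < 3) :
    ∃ j ∉ T, 0 < Γ.gramEigenvalues c κ j := by
  have h3 : c (b 3) = κ := by rw [h.color hc 2, h.color hc 1, Bool.not_not, hκ]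
  have h5 : c (b 5) = κ := by rw [h.color hc 4, h.color hc 3, Bool.not_not, h3]
  refine exists_eigenvalue_colorGram_pos (A := Γ.adjMatrix) (c := c) (κ := κ)
    (a := ![b 1, b 3, b 5]) (T := T) (by simp [Fin.forall_fin_succ, hκ, h3, h5]) hT fun r hr => ?_
  have z03 := h.adjMatrix_eq_zero (i := 0) (j := 3) (by omega) (by omega) (by simp) (by simp)
  have z05 := h.adjMatrix_eq_zero (i := 0) (j := 5) (by omega) (by omega) (by simp) (by simp)
  have z25 := h.adjMatrix_eq_zero (i := 2) (j := 5) (by omega) (by omega) (by simp) (by simp)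
  have z61 := h.adjMatrix_eq_zero (i := 6) (j := 1) (by omega) (by omega) (by simp) (by simp)
  have z63 := h.adjMatrix_eq_zero (i := 6) (j := 3) (by omega) (by omega) (by simp) (by simp)
  have n0 := Γ.adjMatrix_ne_zero.2 (h.adj 0)
  have n2 := Γ.adjMatrix_ne_zero.2 (h.adj 2)
  have n5 := Γ.adjMatrix_ne_zero.2 (h.adj 5).symm
  simp only [Nat.reduceAdd, zero_add] at n0 n2 n5
  have r0 := hr (b 0)
  have r6 := hr (b 6)
  have r2 := hr (b 2)
  simp [Fin.sum_univ_succ, z03, z05, z25, z61, z63, n0, n5] at r0 r2 r6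
  simp [r0, n2] at r2
  ext i
  fin_cases i
  exacts [r0, r2, r6]

theorem IsNegCycle.exists_two_le {g : ℕ} (h : Γ.IsNegCycle g b) (hg : 3 ≤ g)
    (hc : Γ.adjMatrix.IsColoredBy c) (κ : Bool) (i : V) :
    ∃ j ≠ i, 2 ≤ Γ.gramEigenvalues c κ j := by
  -- Colours alternate along the cycle, so a shift by one reaches the other class.
  obtain ⟨b', hb', hκ⟩ : ∃ b', Γ.IsNegCycle g b' ∧ c (b' 1) = κ := by
    by_cases h1 : c (b 1) = κ
    · exact ⟨b, h, h1⟩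
    · refine ⟨_, h.shift, ?_⟩
      rw [h.color hc 1]
      cases κ <;> simp_all
  obtain ⟨l, hl⟩ := hb'.even hc
  rcases (show g = 4 ∨ g = 6 ∨ 8 ≤ g by omega) with rfl | rfl | hg8
  · exact hb'.exists_two_le_of_four hc hκ i
  · obtain ⟨j, hj, hj3⟩ := hb'.exists_three_le_of_six hc hκ i
    exact ⟨j, hj, by linarith⟩
  · exact hb'.exists_two_le_of_eight_le hg8 hc hκ i

theorem IsNegCycle.length_eq_four {g : ℕ} (h : Γ.IsNegCycle g b) (hg : 3 ≤ g)
    (hc : Γ.adjMatrix.IsColoredBy c)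
    (h1 : ∀ κ, ∃ i, ∀ j ≠ i, Γ.gramEigenvalues c κ j ≤ 2)
    (h2 : ∀ κ, ∃ T : Finset V, T.card < 3 ∧ ∀ j ∉ T, Γ.gramEigenvalues c κ j = 0) : g = 4 := by
  obtain ⟨l, hl⟩ := h.even hc
  rcases (show g = 4 ∨ g = 6 ∨ 8 ≤ g by omega) with rfl | rfl | hg8
  · rfl
  · obtain ⟨i, hi⟩ := h1 (c (b 1))
    obtain ⟨j, hj, hj3⟩ := h.exists_three_le_of_six hc rfl i
    linarith [hi j hj]
  · obtain ⟨T, hT, hT0⟩ := h2 (c (b 1))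
    obtain ⟨j, hj, hj0⟩ := h.exists_pos_of_eight_le hg8 hc rfl hT
    exact absurd (hT0 j hj) hj0.ne'

end eigenvalues

end SignedGraph

/-! ### The equality case: vertices outside of a negative 4-cycle -/

namespace SignedGraph

variable {V : Type*} {Γ : SignedGraph V} {b : ℕ → V}

theorem IsNegCycle.shift_add {g : ℕ} (h : Γ.IsNegCycle g b) (n : ℕ) :
    Γ.IsNegCycle g fun i => b (i + n) := by
  induction n with
  | zero => exact h
  | succ n ih => simpa only [add_right_comm, add_assoc] using ih.shift

theorem IsNegCycle.exists_eq_of_four (h : Γ.IsNegCycle 4 b) (j : ℕ) :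
    b j = b 0 ∨ b j = b 1 ∨ b j = b 2 ∨ b j = b 3 := by
  have h1 : b (j % 4) = b j := Function.Periodic.map_mod_nat h.periodic j
  have h2 : j % 4 < 4 := Nat.mod_lt _ (by norm_num)
  rw [← h1]
  interval_cases j % 4 <;> simp

theorem IsNegCycle.exists_edges_of_four (h : Γ.IsNegCycle 4 b) :
    ∃ F : List (Sym2 V), F.length = 4 ∧ F.Nodup ∧ (∀ e ∈ F, e ∈ Γ.graph.edgeSet) ∧
      ∀ e ∈ F, ∀ v ∈ e, v ∈ [b 0, b 1, b 2, b 3] := by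
  have n01 := h.ne (i := 0) (j := 1) (by norm_num) (by norm_num) (by norm_num)
  have n02 := h.ne (i := 0) (j := 2) (by norm_num) (by norm_num) (by norm_num)
  have n03 := h.ne (i := 0) (j := 3) (by norm_num) (by norm_num) (by norm_num)
  have n12 := h.ne (i := 1) (j := 2) (by norm_num) (by norm_num) (by norm_num)
  have n13 := h.ne (i := 1) (j := 3) (by norm_num) (by norm_num) (by norm_num)
  have n23 := h.ne (i := 2) (j := 3) (by norm_num) (by norm_num) (by norm_num)
  have a3 := h.adj 3
  rw [show b (3 + 1) = b 0 from h.periodic 0] at a3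
  refine ⟨[s(b 0, b 1), s(b 1, b 2), s(b 2, b 3), s(b 3, b 0)], rfl, ?_, ?_, ?_⟩
  · simp [n01, n02, n03, n12, n13, n23, n01.symm, n02.symm, n03.symm]
  · simp [h.adj 0, h.adj 1, h.adj 2, a3]
  · simp

theorem IsNegCycle.mem_of_four (h : Γ.IsNegCycle 4 b) (j : ℕ) : b j ∈ [b 0, b 1, b 2, b 3] := by
  simpa using h.exists_eq_of_four j

variable [Fintype V]

/-- Otherwise five vertices would span six edges. -/
theorem IsNegCycle.not_adj_of_four (h : Γ.IsNegCycle 4 b) (hu : Γ.IsUnicyclic) {x : V}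
    (hx : ∀ j, x ≠ b j) {i j : ℕ} (hij : b i ≠ b j) (h1 : Γ.graph.Adj x (b i)) :
    ¬ Γ.graph.Adj x (b j) := by
  intro h2
  obtain ⟨F, hF4, hFn, hFE, hFS⟩ := h.exists_edges_of_four
  have hxF {e : Sym2 V} (hxe : x ∈ e) : e ∉ F := fun he => by
    have := hFS e he x hxe
    simp [hx] at this
  have := hu.1.length_le_length_of_edges hu.2 (S := x :: [b 0, b 1, b 2, b 3])
    (F := s(x, b i) :: s(x, b j) :: F) ?_ ?_ ?_
  · simp [hF4] at this
  · rw [List.nodup_cons, List.nodup_cons, List.mem_cons, not_or]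
    exact ⟨⟨by simp [hij, hx], hxF (by simp)⟩, hxF (by simp), hFn⟩
  · simp only [List.forall_mem_cons]
    exact ⟨h1, h2, hFE⟩
  · simp only [List.forall_mem_cons, Sym2.mem_iff, forall_eq_or_imp, forall_eq]
    exact ⟨⟨List.mem_cons_self, List.mem_cons_of_mem _ (h.mem_of_four i)⟩,
      ⟨List.mem_cons_self, List.mem_cons_of_mem _ (h.mem_of_four j)⟩,
      fun e he v hv => List.mem_cons_of_mem _ (hFS e he v hv)⟩

/-- Otherwise six vertices would span seven edges. -/
theorem IsNegCycle.not_adj_of_adj_of_four (h : Γ.IsNegCycle 4 b) (hu : Γ.IsUnicyclic) {x w : V}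
    (hx : ∀ j, x ≠ b j) (hw : ∀ j, w ≠ b j) {i : ℕ} (hi : Γ.graph.Adj x (b i))
    (hxw : Γ.graph.Adj x w) (j : ℕ) : ¬ Γ.graph.Adj w (b j) := by
  intro h1
  obtain ⟨F, hF4, hFn, hFE, hFS⟩ := h.exists_edges_of_four
  have hF {y : V} (hy : ∀ j, y ≠ b j) {e : Sym2 V} (hye : y ∈ e) : e ∉ F := fun he => by
    have := hFS e he y hye
    simp [hy] at this
  have := hu.1.length_le_length_of_edges hu.2 (S := x :: w :: [b 0, b 1, b 2, b 3])
    (F := s(x, b i) :: s(x, w) :: s(w, b j) :: F) ?_ ?_ ?_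
  · simp [hF4] at this
  · simp only [List.nodup_cons, List.mem_cons, not_or]
    exact ⟨⟨by simp [(hw i).symm, hxw.ne], by simp [hx, hxw.ne], hF hx (by simp)⟩,
      ⟨by simp [hx, hxw.ne], hF hx (by simp)⟩, hF hw (by simp), hFn⟩
  · simp only [List.forall_mem_cons]
    exact ⟨hi, hxw, h1, hFE⟩
  · have hmem (v : V) (hv : v ∈ [b 0, b 1, b 2, b 3]) : v ∈ x :: w :: [b 0, b 1, b 2, b 3] :=
      List.mem_cons_of_mem _ (List.mem_cons_of_mem _ hv)
    simp only [List.forall_mem_cons, Sym2.mem_iff, forall_eq_or_imp, forall_eq]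
    exact ⟨⟨by simp, hmem _ (h.mem_of_four i)⟩, ⟨by simp, by simp⟩,
      ⟨by simp, hmem _ (h.mem_of_four j)⟩, fun e he v hv => hmem v (hFS e he v hv)⟩

variable [DecidableEq V] {c : V → Bool}

/-- With outside neighbours at both `b 1` and `b 3`, these two orthogonal columns would each gain an
entry in a row where the other vanishes. Their squared lengths would be 3, giving two eigenvalues at
least 3. -/
theorem IsNegCycle.not_adj_one_of_adj_three (h : Γ.IsNegCycle 4 b) (hu : Γ.IsUnicyclic)
    (hc : Γ.adjMatrix.IsColoredBy c)
    (h1 : ∃ i, ∀ j ≠ i, Γ.gramEigenvalues c (c (b 1)) j ≤ 2) {x : V} (hx : ∀ j, x ≠ b j)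
    (h3x : Γ.graph.Adj (b 3) x) {y : V} (hy : ∀ j, y ≠ b j) : ¬ Γ.graph.Adj (b 1) y := by
  intro h1y
  obtain ⟨i, hi⟩ := h1
  have n13 := h.ne (i := 1) (j := 3) (by norm_num) (by norm_num) (by norm_num)
  have zx : Γ.adjMatrix x (b 1) = 0 := Γ.adjMatrix_of_not_adj fun e =>
    h.not_adj_of_four hu hx n13 e h3x.symm
  have zy : Γ.adjMatrix y (b 3) = 0 := Γ.adjMatrix_of_not_adj fun e =>
    h.not_adj_of_four hu hy n13 h1y.symm e
  have hxy : x ≠ y := by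
    rintro rfl
    exact Γ.adjMatrix_ne_zero.2 h1y.symm zx
  have h3 : c (b 3) = c (b 1) := by rw [h.color hc 2, h.color hc 1, Bool.not_not]
  have hinj : Function.Injective ![b 0, b 2, x, y] := by
    have n02 := h.ne (i := 0) (j := 2) (by norm_num) (by norm_num) (by norm_num)
    intro i j hij
    have hx' := fun j => (hx j).symm
    have hy' := fun j => (hy j).symm
    fin_cases i <;> fin_cases j <;> simp_all
  obtain ⟨j, hj, hj2⟩ := exists_le_eigenvalue_colorGram (A := Γ.adjMatrix) (c := c)
    (κ := c (b 1)) (a := fun i => b (![1, 3] i)) (T := {i})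
    (h.injective_comp (by decide) (by decide)) (by simp [Fin.forall_fin_two, h3])
    LinearMap.id Function.injective_id (by simp) 3 fun t => by
      refine le_trans (le_of_eq ?_) (sum_sq_comp_le hinj _)
      have s0 := h.sq_eq 0
      have s1 := h.sq_eq 1
      have s2 := h.sq_eq 2
      have s3 := h.sq_eq 3
      have s4 : Γ.adjMatrix x (b 3) ^ 2 = 1 := by
        rw [pow_two, Γ.adjMatrix_mul_self h3x.symm]
      have s5 : Γ.adjMatrix y (b 1) ^ 2 = 1 := by
        rw [pow_two, Γ.adjMatrix_mul_self h1y.symm]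
      have hp := h.prod_eq
      simp only [Finset.prod_range_succ, Finset.prod_range_zero] at hp
      have e4 : b (3 + 1) = b 0 := h.periodic 0
      rw [e4] at s3 hp
      rw [Γ.adjMatrix_comm (b 3)] at s3 hp
      rw [Γ.adjMatrix_comm (b 1)] at s1 hp
      simp only [Nat.reduceAdd, zero_add, one_mul] at s0 s1 s2 s3 hp
      have e : Γ.adjMatrix (b 0) (b 1) * Γ.adjMatrix (b 0) (b 3) =
          -(Γ.adjMatrix (b 2) (b 1) * Γ.adjMatrix (b 2) (b 3)) := by
        linear_combination (-Γ.adjMatrix (b 0) (b 1) * Γ.adjMatrix (b 0) (b 3) *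
          Γ.adjMatrix (b 2) (b 3) ^ 2) * s1 - Γ.adjMatrix (b 0) (b 1) * Γ.adjMatrix (b 0) (b 3) * s2
          + Γ.adjMatrix (b 2) (b 1) * Γ.adjMatrix (b 2) (b 3) * hp
      simp only [LinearMap.id_apply, Fin.sum_univ_succ, Fin.isValue, Finset.univ_unique,
        Fin.default_eq_zero, Finset.sum_singleton, cons_val_zero, cons_val_succ, zx, zy,
        Fin.succ_zero_eq_one]
      linear_combination (-t 0 ^ 2) * s0 - t 0 ^ 2 * s1 - t 1 ^ 2 * s2 - t 1 ^ 2 * s3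
        - t 1 ^ 2 * s4 - t 0 ^ 2 * s5 - 2 * t 0 * t 1 * e
  linarith [hi j (by simpa using hj), show 3 ≤ Γ.gramEigenvalues c (c (b 1)) j from hj2]

/-- If `w` had the colour of `b 1`, the columns `b 1, b 3, w` would be independent, and the Gram
matrix would have rank at least 3. -/
theorem IsNegCycle.color_ne_of_adj_three (h : Γ.IsNegCycle 4 b) (hu : Γ.IsUnicyclic)
    (hc : Γ.adjMatrix.IsColoredBy c)
    (h2 : ∃ T : Finset V, T.card < 3 ∧ ∀ j ∉ T, Γ.gramEigenvalues c (c (b 1)) j = 0)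
    {x : V} (hx : ∀ j, x ≠ b j) (h3x : Γ.graph.Adj (b 3) x) {w : V} (hw : ∀ j, w ≠ b j) :
    c w ≠ c (b 1) := by
  intro hcw
  have h3 : c (b 3) = c (b 1) := by rw [h.color hc 2, h.color hc 1, Bool.not_not]
  obtain ⟨T, hT, hT0⟩ := h2
  have n13 := h.ne (i := 1) (j := 3) (by norm_num) (by norm_num) (by norm_num)
  have zx : Γ.adjMatrix x (b 1) = 0 := Γ.adjMatrix_of_not_adj fun e =>
    h.not_adj_of_four hu hx n13 e h3x.symm
  -- Only used to obtain some neighbour of `w`.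
  obtain ⟨p, ρ, hp⟩ := hu.1.exists_parent (Set.singleton_nonempty (b 0))
  have hwp : Γ.graph.Adj w (p w) := (hp w (by simpa using hw 0)).1
  obtain ⟨j, hj, hj0⟩ := exists_eigenvalue_colorGram_pos (A := Γ.adjMatrix) (c := c)
    (κ := c (b 1)) (a := ![b 1, b 3, w]) (T := T) (by simp [Fin.forall_fin_succ, h3, hcw]) hT
    fun r hr => by
      have hr' (u : V) : Γ.adjMatrix u (b 1) * r 0 + Γ.adjMatrix u (b 3) * r 1 +
          Γ.adjMatrix u w * r 2 = 0 := by
        have := hr u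
        simpa [Fin.sum_univ_succ, add_assoc] using this
      have r0 := hr' (b 0)
      have r2 := hr' (b 2)
      have rx := hr' x
      have rp := hr' (p w)
      have s0 := h.sq_eq 0
      have s1 := h.sq_eq 1
      have s2 := h.sq_eq 2
      have s3 := h.sq_eq 3
      have hp := h.prod_eq
      simp only [Finset.prod_range_succ, Finset.prod_range_zero] at hp
      have e4 : b (3 + 1) = b 0 := h.periodic 0
      rw [e4] at s3 hp
      rw [Γ.adjMatrix_comm (b 3)] at s3 hp
      rw [Γ.adjMatrix_comm (b 1)] at s1 hp
      simp only [Nat.reduceAdd, zero_add, one_mul] at s0 s1 s2 s3 hp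
      have n02 := h.ne (i := 0) (j := 2) (by norm_num) (by norm_num) (by norm_num)
      have nx := Γ.adjMatrix_ne_zero.2 h3x.symm
      have nw := Γ.adjMatrix_ne_zero.2 hwp.symm
      have n01 : Γ.adjMatrix (b 0) (b 1) ≠ 0 := Γ.adjMatrix_ne_zero.2 (h.adj 0)
      have n21 : Γ.adjMatrix (b 2) (b 1) ≠ 0 := Γ.adjMatrix_ne_zero.2 (h.adj 1).symm
      -- If `x` is adjacent to `w`, the rows `b 0, b 2` do not see `w`, and their `2 × 2` block is
      -- invertible. If not, row `x` isolates `b 3`, and since `w` is adjacent to at most one of `b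
      -- 0, b 2`, the row of the other isolates `b 1`.
      have key : r 0 = 0 ∧ r 1 = 0 := by
        by_cases hxw : Γ.graph.Adj x w
        · have z0 : Γ.adjMatrix (b 0) w = 0 := Γ.adjMatrix_of_not_adj fun e =>
            h.not_adj_of_adj_of_four hu hx hw h3x.symm hxw 0 e.symm
          have z2 : Γ.adjMatrix (b 2) w = 0 := Γ.adjMatrix_of_not_adj fun e =>
            h.not_adj_of_adj_of_four hu hx hw h3x.symm hxw 2 e.symm
          rw [z0, zero_mul, add_zero] at r0
          rw [z2, zero_mul, add_zero] at r2
          have h1 : r 1 = 0 := by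
            generalize Γ.adjMatrix (b 0) (b 1) = p at *
            generalize Γ.adjMatrix (b 0) (b 3) = q at *
            generalize Γ.adjMatrix (b 2) (b 1) = p' at *
            generalize Γ.adjMatrix (b 2) (b 3) = q' at *
            have e1 : (p * q - p' * q') * r 1 = 0 := by
              linear_combination p * r0 - p' * r2 - r 0 * s0 + r 0 * s1
            have e2 : (p * q - p' * q') ^ 2 = 4 := by
              linear_combination q ^ 2 * s0 + s3 + q' ^ 2 * s1 + s2 - 2 * hp
            have e3 : p * q - p' * q' ≠ 0 := fun h0 => by rw [h0] at e2; norm_num at e2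
            exact (mul_eq_zero.1 e1).resolve_left e3
          refine ⟨?_, h1⟩
          simpa [h1, n01] using r0
        · have z : Γ.adjMatrix x w = 0 := Γ.adjMatrix_of_not_adj hxw
          have h1 : r 1 = 0 := by simpa [zx, z, nx] using rx
          refine ⟨?_, h1⟩
          by_cases hw0 : Γ.graph.Adj w (b 0)
          · have z2 : Γ.adjMatrix (b 2) w = 0 := Γ.adjMatrix_of_not_adj fun e =>
              h.not_adj_of_four hu hw n02 hw0 e.symm
            simpa [z2, h1, n21] using r2
          · have z0 : Γ.adjMatrix (b 0) w = 0 := Γ.adjMatrix_of_not_adj fun e => hw0 e.symm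
            simpa [z0, h1, n01] using r0
      have h2 : r 2 = 0 := by simpa [key.1, key.2, nw] using rp
      ext i
      fin_cases i
      exacts [key.1, key.2, h2]
  exact hj0.ne' (hT0 j hj)

/-- If the eigenvalues of the Gram matrices of an unbalanced bipartite unicyclic signed graph with
a 4-cycle are extremal, then all vertices outside of the cycle are adjacent to the same vertex of
the cycle. -/
theorem IsNegCycle.exists_adj_of_four (h : Γ.IsNegCycle 4 b) (hu : Γ.IsUnicyclic)
    (hc : Γ.adjMatrix.IsColoredBy c)
    (h1 : ∀ κ, ∃ i, ∀ j ≠ i, Γ.gramEigenvalues c κ j ≤ 2)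
    (h2 : ∀ κ, ∃ T : Finset V, T.card < 3 ∧ ∀ j ∉ T, Γ.gramEigenvalues c κ j = 0) :
    ∃ b', Γ.IsNegCycle 4 b' ∧ ∀ v, (∀ j, v ≠ b' j) → Γ.graph.Adj (b' 3) v := by
  by_cases hex : ∃ i x, (∀ j, x ≠ b j) ∧ Γ.graph.Adj (b i) x
  · obtain ⟨i, x, hx, hix⟩ := hex
    -- Rotates the cycle so that the vertex with an outside neighbour becomes number 3.
    have h' := h.shift_add (i + 1)
    have hx' : ∀ j, x ≠ b (j + (i + 1)) := fun j => hx _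
    have hix' : Γ.graph.Adj (b (3 + (i + 1))) x := by
      rwa [show 3 + (i + 1) = i + 4 by ring, h.periodic]
    refine ⟨_, h', fun v hv => ?_⟩
    obtain ⟨p, ρ, hp⟩ := hu.1.exists_parent (Set.singleton_nonempty (b (0 + (i + 1))))
    have hvp : Γ.graph.Adj v (p v) := (hp v (by simpa using hv 0)).1
    have hcv := h'.color_ne_of_adj_three hu hc (h2 _) hx' hix' hv
    have hcp : c (p v) = c (b (1 + (i + 1))) := by
      rw [hc.eq_not (Γ.adjMatrix_ne_zero.2 hvp)]
      rw [Bool.not_eq_eq_eq_not]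
      exact Bool.eq_not_of_ne hcv
    -- Outside vertices never have the colour of the vertex number 1, but the neighbour `p v` does.
    -- So it lies on the cycle, as number 1 or 3.
    have hmem : ∃ j, p v = b (j + (i + 1)) := by
      by_contra! hne
      exact h'.color_ne_of_adj_three hu hc (h2 _) hx' hix' hne hcp
    obtain ⟨j, hj⟩ := hmem
    have hcj := h'.color hc
    have hp4 := h'.exists_eq_of_four j
    rw [hj] at hvp hcp
    have c1 := hcj 0
    have c2 := hcj 1
    simp only [Nat.reduceAdd] at c1 c2
    rcases hp4 with e | e | e | e <;> rw [e] at hvp hcp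
    · rw [hcp] at c1; simp at c1
    · exact absurd hvp.symm (h'.not_adj_one_of_adj_three hu hc (h1 _) hx' hix' hv)
    · rw [hcp] at c2; simp at c2
    · exact hvp.symm
  -- No edge leaves the cycle, so by connectedness there are no outside vertices.
  · push Not at hex
    have key {u v : V} (q : Γ.graph.Walk u v) (hq : ∃ j, u = b j) : ∃ j, v = b j := by
      induction q with
      | nil => exact hq
      | cons huv q ih =>
        obtain ⟨j, rfl⟩ := hq
        refine ih ?_
        by_contra! hne
        exact hex j _ hne huv
    refine ⟨b, h, fun v hv => ?_⟩
    obtain ⟨q⟩ := hu.1.preconnected (b 0) v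
    obtain ⟨j, hj⟩ := key q ⟨0, rfl⟩
    exact absurd hj (hv j)

end SignedGraph

/-! ### The extremal signed graph -/

namespace SignedGraph

section negFourCycleWithPendants

variable {n : ℕ}

theorem negFourCycleWithPendants_adj {i j : Fin n} :
    (negFourCycleWithPendants n).graph.Adj i j ↔
      ((i : ℕ) = 0 ∧ ((j : ℕ) = 1 ∨ 3 ≤ (j : ℕ))) ∨ ((j : ℕ) = 0 ∧ ((i : ℕ) = 1 ∨ 3 ≤ (i : ℕ))) ∨
      ((i : ℕ) = 2 ∧ ((j : ℕ) = 1 ∨ (j : ℕ) = 3)) ∨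
      ((j : ℕ) = 2 ∧ ((i : ℕ) = 1 ∨ (i : ℕ) = 3)) := by
  simp only [negFourCycleWithPendants, SimpleGraph.fromRel_adj, ne_eq, Fin.ext_iff]
  omega

theorem negFourCycleWithPendants_adjMatrix (i j : Fin n) :
    (negFourCycleWithPendants n).adjMatrix i j =
      if (((i : ℕ) = 0 ∧ ((j : ℕ) = 1 ∨ 3 ≤ (j : ℕ))) ∨ ((j : ℕ) = 0 ∧ ((i : ℕ) = 1 ∨ 3 ≤ (i : ℕ))) ∨
          ((i : ℕ) = 2 ∧ ((j : ℕ) = 1 ∨ (j : ℕ) = 3)) ∨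
          ((j : ℕ) = 2 ∧ ((i : ℕ) = 1 ∨ (i : ℕ) = 3))) then
        if ((i : ℕ) = 0 ∧ (j : ℕ) = 3) ∨ ((i : ℕ) = 3 ∧ (j : ℕ) = 0) then -1 else 1
      else 0 := by
  split_ifs with h h' <;> rw [← negFourCycleWithPendants_adj] at h
  · rw [adjMatrix_of_adj _ h]
    have : ∃ a b : Fin n, (a : ℕ) = 0 ∧ (b : ℕ) = 3 ∧ s(i, j) = s(a, b) := by
      rcases h' with ⟨h1, h2⟩ | ⟨h1, h2⟩
      exacts [⟨i, j, h1, h2, rfl⟩, ⟨j, i, h2, h1, Sym2.eq_swap⟩]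
    simp only [negFourCycleWithPendants, if_pos this]
    simp
  · rw [adjMatrix_of_adj _ h]
    have : ¬ ∃ a b : Fin n, (a : ℕ) = 0 ∧ (b : ℕ) = 3 ∧ s(i, j) = s(a, b) := by
      rintro ⟨a, b, h1, h2, h3⟩
      rcases Sym2.eq_iff.1 h3 with ⟨rfl, rfl⟩ | ⟨rfl, rfl⟩
      exacts [h' (Or.inl ⟨h1, h2⟩), h' (Or.inr ⟨h2, h1⟩)]
    simp only [negFourCycleWithPendants, if_neg this]
    simp
  · exact adjMatrix_of_not_adj _ h

theorem negFourCycleWithPendants_connected (hn : 4 ≤ n) :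
    (negFourCycleWithPendants n).graph.Connected := by
  obtain ⟨z, hz⟩ : ∃ z : Fin n, (z : ℕ) = 0 := ⟨⟨0, by omega⟩, rfl⟩
  obtain ⟨z₁, hz₁⟩ : ∃ z : Fin n, (z : ℕ) = 1 := ⟨⟨1, by omega⟩, rfl⟩
  have h0 (j : Fin n) : (negFourCycleWithPendants n).graph.Reachable z j := by
    by_cases h2 : (j : ℕ) = 2
    · have h1 : (negFourCycleWithPendants n).graph.Adj z z₁ := by
        simp [negFourCycleWithPendants_adj, hz, hz₁]
      have h3 : (negFourCycleWithPendants n).graph.Adj z₁ j := by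
        simp [negFourCycleWithPendants_adj, h2, hz₁]
      exact h1.reachable.trans h3.reachable
    · by_cases hj : (j : ℕ) = 0
      · rw [show j = z from Fin.ext (hj.trans hz.symm)]
      · refine SimpleGraph.Adj.reachable ?_
        rw [negFourCycleWithPendants_adj]
        omega
  have : Nonempty (Fin n) := ⟨z⟩
  exact ⟨fun i j => (h0 i).symm.trans (h0 j)⟩

theorem ncard_edgeSet_negFourCycleWithPendants (hn : 4 ≤ n) :
    (negFourCycleWithPendants n).graph.edgeSet.ncard = n := by
  let z (i : ℕ) (hi : i < 4) : Fin n := ⟨i, by omega⟩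
  -- Lists the edges by vertices: `i ↦ {0, i}` except at 0 and 2, the two vertices not adjacent to
  -- 0, which index the two edges of the cycle at 2.
  let φ : Fin n → Sym2 (Fin n) := fun i =>
    if (i : ℕ) = 0 then s(z 2 (by norm_num), z 3 (by norm_num))
    else if (i : ℕ) = 2 then s(z 1 (by norm_num), z 2 (by norm_num))
    else s(z 0 (by norm_num), i)
  have hinj : Function.Injective φ := by
    intro i j hij
    simp only [φ, z] at hij
    ext
    split_ifs at hij <;> simp only [Sym2.eq_iff, Fin.ext_iff] at hij <;> omega
  have hrange : (negFourCycleWithPendants n).graph.edgeSet = Set.range φ := by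
    ext e
    induction e with | _ i j
    simp only [SimpleGraph.mem_edgeSet, negFourCycleWithPendants_adj, Set.mem_range, φ]
    constructor
    · intro h
      obtain ⟨z₀, hz₀⟩ : ∃ z : Fin n, (z : ℕ) = 0 := ⟨⟨0, by omega⟩, rfl⟩
      obtain ⟨z₂, hz₂⟩ : ∃ z : Fin n, (z : ℕ) = 2 := ⟨⟨2, by omega⟩, rfl⟩
      have key : ∃ k : Fin n, ((k : ℕ) = 0 ∧ ((i : ℕ) = 2 ∧ (j : ℕ) = 3 ∨ (i : ℕ) = 3 ∧ (j : ℕ) = 2))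
          ∨ ((k : ℕ) = 2 ∧ ((i : ℕ) = 1 ∧ (j : ℕ) = 2 ∨ (i : ℕ) = 2 ∧ (j : ℕ) = 1)) ∨
          ((k : ℕ) ≠ 0 ∧ (k : ℕ) ≠ 2 ∧
            ((i : ℕ) = 0 ∧ (j : ℕ) = k ∨ (i : ℕ) = k ∧ (j : ℕ) = 0)) := by
        rcases h with h | h | h | h
        · exact ⟨j, by omega⟩
        · exact ⟨i, by omega⟩
        · by_cases hj : (j : ℕ) = 1
          · exact ⟨z₂, by omega⟩
          · exact ⟨z₀, by omega⟩
        · by_cases hi : (i : ℕ) = 1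
          · exact ⟨z₂, by omega⟩
          · exact ⟨z₀, by omega⟩
      obtain ⟨k, hk⟩ := key
      refine ⟨k, ?_⟩
      split_ifs <;> simp only [Sym2.eq_iff, Fin.ext_iff, z] <;> omega
    · rintro ⟨k, hk⟩
      split_ifs at hk <;> simp only [Sym2.eq_iff, Fin.ext_iff, z] at hk <;> omega
  rw [hrange, ← Set.image_univ, Set.ncard_image_of_injective _ hinj, Set.ncard_univ, Nat.card_fin]

theorem negFourCycleWithPendants_isBipartite :
    (negFourCycleWithPendants n).graph.IsBipartite := by
  refine ⟨SimpleGraph.Coloring.mk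
    (fun i => if (i : ℕ) = 0 ∨ (i : ℕ) = 2 then (0 : Fin 2) else 1) fun {i j} h => ?_⟩
  rw [negFourCycleWithPendants_adj] at h
  split_ifs <;> first | decide | omega

theorem not_isBalanced_negFourCycleWithPendants (hn : 4 ≤ n) :
    ¬ (negFourCycleWithPendants n).IsBalanced := by
  intro h
  have h01 : (negFourCycleWithPendants n).graph.Adj ⟨0, by omega⟩ ⟨1, by omega⟩ := by
    simp [negFourCycleWithPendants_adj]
  have h12 : (negFourCycleWithPendants n).graph.Adj ⟨1, by omega⟩ ⟨2, by omega⟩ := by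
    simp [negFourCycleWithPendants_adj]
  have h23 : (negFourCycleWithPendants n).graph.Adj ⟨2, by omega⟩ ⟨3, by omega⟩ := by
    simp [negFourCycleWithPendants_adj]
  have h30 : (negFourCycleWithPendants n).graph.Adj ⟨3, by omega⟩ ⟨0, by omega⟩ := by
    simp [negFourCycleWithPendants_adj]
  have hs := h _ (.cons h01 (.cons h12 (.cons h23 (.cons h30 .nil)))) (by
    simp [SimpleGraph.Walk.isCycle_def, SimpleGraph.Walk.isTrail_def])
  have hs' := walkSign_eq_prod _
    (SimpleGraph.Walk.cons h01 (.cons h12 (.cons h23 (.cons h30 .nil))))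
  rw [hs] at hs'
  simp [Finset.prod_range_succ, negFourCycleWithPendants_adjMatrix] at hs'
  norm_num at hs'

theorem isUnbalancedBipartiteUnicyclic_negFourCycleWithPendants (hn : 4 ≤ n) :
    (negFourCycleWithPendants n).IsUnbalancedBipartiteUnicyclic :=
  ⟨⟨negFourCycleWithPendants_connected hn,
    by rw [ncard_edgeSet_negFourCycleWithPendants hn, Fintype.card_fin]⟩,
    negFourCycleWithPendants_isBipartite, not_isBalanced_negFourCycleWithPendants hn⟩

theorem isColoredBy_negFourCycleWithPendants :
    (negFourCycleWithPendants n).adjMatrix.IsColoredBy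
      fun i => decide ((i : ℕ) = 0 ∨ (i : ℕ) = 2) := by
  intro i j hij
  rw [adjMatrix_ne_zero, negFourCycleWithPendants_adj] at hij
  simp only [ne_eq, decide_eq_decide]
  omega

/-- On the class `{0, 2}` the Gram matrix is diagonal: the common neighbours 1 and 3 contribute with
opposite signs. The diagonal entries are the degrees `n - 2` and `2`. -/
theorem trace_colorGram_negFourCycleWithPendants_pow (hn : 4 ≤ n) {k : ℕ} (hk : k ≠ 0) :
    (colorGram (negFourCycleWithPendants n).adjMatrix
      (fun i => decide ((i : ℕ) = 0 ∨ (i : ℕ) = 2)) true ^ k).trace =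
      ((n : ℝ) - 2) ^ k + 2 ^ k := by
  have hdiag : colorGram (negFourCycleWithPendants n).adjMatrix
      (fun i => decide ((i : ℕ) = 0 ∨ (i : ℕ) = 2)) true =
      diagonal fun i : Fin n => if (i : ℕ) = 0 then (n : ℝ) - 2 else if (i : ℕ) = 2 then 2 else 0 := by
    rw [isColoredBy_negFourCycleWithPendants.colorGram_eq (adjMatrix_isHermitian _)]
    ext i j
    rw [colorProj, diagonal_mul, mul_apply, diagonal_apply]
    by_cases hi : (i : ℕ) = 0 ∨ (i : ℕ) = 2
    swap
    · simp only [hi, decide_false, Bool.false_eq_true, if_false, zero_mul]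
      rw [not_or] at hi
      simp [hi.1, hi.2]
    simp only [hi, decide_true, if_true, one_mul]
    by_cases hj : (j : ℕ) = 0 ∨ (j : ℕ) = 2
    swap
    · rw [if_neg (by rintro rfl; exact hj hi)]
      refine Finset.sum_eq_zero fun l _ => ?_
      by_contra h0
      have h1 := left_ne_zero_of_mul h0
      have h2 := right_ne_zero_of_mul h0
      rw [adjMatrix_ne_zero, negFourCycleWithPendants_adj] at h1 h2
      omega
    have hA (l : Fin n) : (negFourCycleWithPendants n).adjMatrix i l *
        (negFourCycleWithPendants n).adjMatrix l j =
        if (i : ℕ) = 0 then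
          if (j : ℕ) = 0 then 1 - (if l = ⟨0, by omega⟩ then 1 else 0) -
            (if l = ⟨2, by omega⟩ then 1 else 0)
          else (if l = ⟨1, by omega⟩ then 1 else 0) - (if l = ⟨3, by omega⟩ then 1 else 0)
        else
          if (j : ℕ) = 0 then
            (if l = ⟨1, by omega⟩ then 1 else 0) - (if l = ⟨3, by omega⟩ then 1 else 0)
          else (if l = ⟨1, by omega⟩ then 1 else 0) + (if l = ⟨3, by omega⟩ then 1 else 0) := by
      simp only [negFourCycleWithPendants_adjMatrix, Fin.ext_iff]
      have hl : (l : ℕ) = 0 ∨ (l : ℕ) = 1 ∨ (l : ℕ) = 2 ∨ (l : ℕ) = 3 ∨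
          ((l : ℕ) ≠ 0 ∧ (l : ℕ) ≠ 1 ∧ (l : ℕ) ≠ 2 ∧ (l : ℕ) ≠ 3 ∧ 3 ≤ (l : ℕ)) := by omega
      rcases hi with hi | hi <;> rcases hj with hj | hj <;>
        rcases hl with hl | hl | hl | hl | hl <;> simp [hi, hj, hl]
    simp_rw [hA]
    rcases hi with hi | hi <;> rcases hj with hj | hj
    · rw [if_pos (Fin.ext (hi.trans hj.symm))]
      simp [hi, hj]
      ring
    · rw [if_neg (by rintro rfl; omega)]
      simp [hi, hj]
    · rw [if_neg (by rintro rfl; omega)]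
      simp [hi, hj]
    · rw [if_pos (Fin.ext (hi.trans hj.symm))]
      simp [hi, hj, Finset.sum_add_distrib]
      norm_num
  rw [hdiag, diagonal_pow, trace_diagonal]
  have (i : Fin n) : ((fun i : Fin n => if (i : ℕ) = 0 then (n : ℝ) - 2 else
      if (i : ℕ) = 2 then 2 else 0) ^ k) i = (if i = ⟨0, by omega⟩ then ((n : ℝ) - 2) ^ k else 0) +
        (if i = ⟨2, by omega⟩ then 2 ^ k else 0) := by
    simp only [Pi.pow_apply, Fin.ext_iff]
    by_cases h0 : (i : ℕ) = 0
    · simp [h0]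
    · by_cases h2 : (i : ℕ) = 2 <;> simp [h0, h2, hk]
  simp_rw [this, Finset.sum_add_distrib, Finset.sum_ite_eq', Finset.mem_univ, if_true]

/-- A unicyclic signed graph in which all vertices outside of a negative 4-cycle are adjacent to the
same vertex of the cycle is determined up to switching equivalence by the number of vertices. -/
theorem IsNegCycle.switchingEquivalent {V : Type*} [Fintype V] {Γ : SignedGraph V}
    (hu : Γ.IsUnicyclic) {b : ℕ → V} (h : Γ.IsNegCycle 4 b)
    (hb : ∀ v, (∀ j, v ≠ b j) → Γ.graph.Adj (b 3) v) (hn : 4 ≤ n) (hV : Fintype.card V = n) :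
    Γ.SwitchingEquivalent (negFourCycleWithPendants n) := by
  classical
  -- The cycle is read backwards, so that the vertex `b 3` that carries the pendant vertices becomes
  -- 0; the rest of the bijection is arbitrary.
  obtain ⟨g, hg⟩ := Finset.exists_equiv_extend_of_card_eq (α := Fin n) (t := (Finset.univ : Finset V))
    (by simp [hV]) (s := Finset.univ.filter fun i => (i : ℕ) < 4) (f := fun i => b (3 - (i : ℕ)))
    (Finset.subset_univ _) (by
      intro i hi j hj hij
      simp only [Finset.coe_filter, Finset.mem_univ, true_and, Set.mem_ofPred_eq] at hi hj
      by_contra hne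
      rw [Fin.ext_iff] at hne
      exact h.ne (by omega) (by omega) (show 3 - (i : ℕ) ≠ 3 - (j : ℕ) by omega) hij)
  let e : Fin n ≃ V := g.trans (Equiv.subtypeUnivEquiv fun v => Finset.mem_univ v)
  have he (i : Fin n) (hi : (i : ℕ) < 4) : e i = b (3 - (i : ℕ)) := hg i (by simpa using hi)
  have he0 {i : Fin n} (hi : (i : ℕ) = 0) : e i = b 3 := by rw [he i (by omega), hi]
  have he1 {i : Fin n} (hi : (i : ℕ) = 1) : e i = b 2 := by rw [he i (by omega), hi]
  have he2 {i : Fin n} (hi : (i : ℕ) = 2) : e i = b 1 := by rw [he i (by omega), hi]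
  have he3 {i : Fin n} (hi : (i : ℕ) = 3) : e i = b 0 := by rw [he i (by omega), hi]
  have he4 {i : Fin n} (hi : 4 ≤ (i : ℕ)) (j : ℕ) : e i ≠ b j := by
    have hex : ∃ k : Fin n, (k : ℕ) < 4 ∧ e k = b j := by
      rcases h.exists_eq_of_four j with hj | hj | hj | hj <;> rw [hj]
      exacts [⟨⟨3, by omega⟩, by simp, he3 rfl⟩, ⟨⟨2, by omega⟩, by simp, he2 rfl⟩,
        ⟨⟨1, by omega⟩, by simp, he1 rfl⟩, ⟨⟨0, by omega⟩, by simp, he0 rfl⟩]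
    obtain ⟨k, hk, hkj⟩ := hex
    rw [← hkj]
    intro hik
    rw [e.injective hik] at hi
    omega
  have a0 := h.adj 0
  have a1 := h.adj 1
  have a2 := h.adj 2
  have a3 := h.adj 3
  have e4 : b (3 + 1) = b 0 := h.periodic 0
  rw [e4] at a3
  simp only [Nat.reduceAdd, zero_add] at a0 a1 a2
  have hadj' {i j : Fin n} (hij : (((i : ℕ) = 0 ∧ ((j : ℕ) = 1 ∨ 3 ≤ (j : ℕ))) ∨
      ((i : ℕ) = 2 ∧ ((j : ℕ) = 1 ∨ (j : ℕ) = 3)))) : Γ.graph.Adj (e i) (e j) := by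
    rcases hij with ⟨hi, hj⟩ | ⟨hi, hj⟩
    · rw [he0 hi]
      rcases (show (j : ℕ) = 1 ∨ (j : ℕ) = 3 ∨ 4 ≤ (j : ℕ) by omega) with hj | hj | hj
      · rw [he1 hj]; exact a2.symm
      · rw [he3 hj]; exact a3
      · exact hb _ (he4 hj)
    · rw [he2 hi]
      rcases hj with hj | hj
      · rw [he1 hj]; exact a1
      · rw [he3 hj]; exact a0.symm
  have hadj {i j : Fin n} (hij : (negFourCycleWithPendants n).graph.Adj i j) :
      Γ.graph.Adj (e i) (e j) := by
    rw [negFourCycleWithPendants_adj] at hij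
    rcases hij with hij | hij | hij | hij
    · exact hadj' (Or.inl hij)
    · exact (hadj' (Or.inl hij)).symm
    · exact hadj' (Or.inr hij)
    · exact (hadj' (Or.inr hij)).symm
  have hinj : Function.Injective (Sym2.map e) := Sym2.map.injective e.injective
  -- The image of the edge set is contained in the edge set of `Γ`, and both have `n` elements.
  have hmap : Sym2.map e '' (negFourCycleWithPendants n).graph.edgeSet = Γ.graph.edgeSet := by
    refine Set.eq_of_subset_of_ncard_le ?_ ?_ (Set.toFinite _)
    · rintro _ ⟨x, hx, rfl⟩
      induction x with | _ i j
      exact hadj hx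
    · rw [Set.ncard_image_of_injective _ hinj, ncard_edgeSet_negFourCycleWithPendants hn, hu.2, hV]
  have hiff (i j : Fin n) :
      Γ.graph.Adj (e i) (e j) ↔ (negFourCycleWithPendants n).graph.Adj i j := by
    rw [← SimpleGraph.mem_edgeSet, ← hmap, ← Sym2.map_mk, hinj.mem_set_image,
      SimpleGraph.mem_edgeSet]
  -- Determined from `b 3` outwards: the pendant edges and the path `b 3, b 2, b 1` become positive
  -- and the edge `b 3 b 0` negative. The edge `b 0 b 1` then becomes positive because the cycle is
  -- negative.
  let θ : V → ℝ := fun v => if v = b 3 then 1 else if v = b 1 then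
    Γ.adjMatrix (b 3) (b 2) * Γ.adjMatrix (b 2) (b 1) else if v = b 0 then -Γ.adjMatrix (b 3) (b 0)
    else Γ.adjMatrix (b 3) v
  have n01 := h.ne (i := 0) (j := 1) (by norm_num) (by norm_num) (by norm_num)
  have n02 := h.ne (i := 0) (j := 2) (by norm_num) (by norm_num) (by norm_num)
  have n03 := h.ne (i := 0) (j := 3) (by norm_num) (by norm_num) (by norm_num)
  have n12 := h.ne (i := 1) (j := 2) (by norm_num) (by norm_num) (by norm_num)
  have n13 := h.ne (i := 1) (j := 3) (by norm_num) (by norm_num) (by norm_num)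
  have n23 := h.ne (i := 2) (j := 3) (by norm_num) (by norm_num) (by norm_num)
  have t0 : θ (b 0) = -Γ.adjMatrix (b 3) (b 0) := by simp [θ, n01, n03]
  have t1 : θ (b 1) = Γ.adjMatrix (b 3) (b 2) * Γ.adjMatrix (b 2) (b 1) := by simp [θ, n13]
  have t2 : θ (b 2) = Γ.adjMatrix (b 3) (b 2) := by simp [θ, n02.symm, n12.symm, n23]
  have t3 : θ (b 3) = 1 := by simp [θ]
  have t4 {v : V} (hv : ∀ j, v ≠ b j) : θ v = Γ.adjMatrix (b 3) v := by simp [θ, hv]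
  have m0 := Γ.adjMatrix_mul_self a0
  have m1 := Γ.adjMatrix_mul_self a1.symm
  have m2 := Γ.adjMatrix_mul_self a2.symm
  have m3 := Γ.adjMatrix_mul_self a3
  have hp := h.prod_eq
  simp only [Finset.prod_range_succ, Finset.prod_range_zero, e4, Nat.reduceAdd, zero_add,
    one_mul] at hp
  rw [Γ.adjMatrix_comm (b 1), Γ.adjMatrix_comm (b 2) (b 3)] at hp
  have hθ (v : V) : θ v * θ v = 1 := by
    by_cases hv : ∀ j, v ≠ b j
    · rw [t4 hv]
      exact Γ.adjMatrix_mul_self (hb v hv)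
    · push Not at hv
      obtain ⟨j, rfl⟩ := hv
      rcases h.exists_eq_of_four j with hj | hj | hj | hj <;> rw [hj]
      · rw [t0, neg_mul_neg, m3]
      · rw [t1, mul_mul_mul_comm, m1, m2, one_mul]
      · rw [t2, m2]
      · rw [t3, one_mul]
  have hA {i j : Fin n} (hij : (((i : ℕ) = 0 ∧ ((j : ℕ) = 1 ∨ 3 ≤ (j : ℕ))) ∨
      ((i : ℕ) = 2 ∧ ((j : ℕ) = 1 ∨ (j : ℕ) = 3)))) : (negFourCycleWithPendants n).adjMatrix i j =
        θ (e i) * θ (e j) * Γ.adjMatrix (e i) (e j) := by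
    rw [negFourCycleWithPendants_adjMatrix, if_pos (by tauto)]
    rcases hij with ⟨hi, hj⟩ | ⟨hi, hj⟩
    · rw [he0 hi, t3]
      rcases (show (j : ℕ) = 1 ∨ (j : ℕ) = 3 ∨ 4 ≤ (j : ℕ) by omega) with hj | hj | hj
      · rw [if_neg (by omega), he1 hj, t2, one_mul, m2]
      · rw [if_pos (by omega), he3 hj, t0, one_mul, neg_mul, m3]
      · rw [if_neg (by omega), t4 (he4 hj), one_mul, Γ.adjMatrix_mul_self (hb _ (he4 hj))]
    · rw [he2 hi, t1, if_neg (by omega)]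
      rcases hj with hj | hj
      · rw [he1 hj, t2, Γ.adjMatrix_comm (b 1)]
        linear_combination -m2 - Γ.adjMatrix (b 3) (b 2) ^ 2 * m1
      · rw [he3 hj, t0, Γ.adjMatrix_comm (b 1)]
        linear_combination hp
  refine (switchingEquivalent_iff _ _).2 ⟨e.symm, θ, hθ, fun u v => ?_⟩
  obtain ⟨i, rfl⟩ := e.surjective u
  obtain ⟨j, rfl⟩ := e.surjective v
  rw [e.symm_apply_apply, e.symm_apply_apply]
  by_cases hij : (negFourCycleWithPendants n).graph.Adj i j
  · rw [negFourCycleWithPendants_adj] at hij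
    rcases hij with hij | hij | hij | hij
    · exact hA (Or.inl hij)
    · rw [adjMatrix_comm, hA (Or.inl hij), Γ.adjMatrix_comm, mul_comm (θ _)]
    · exact hA (Or.inr hij)
    · rw [adjMatrix_comm, hA (Or.inr hij), Γ.adjMatrix_comm, mul_comm (θ _)]
  · rw [adjMatrix_of_not_adj _ hij, adjMatrix_of_not_adj _ ((hiff i j).not.2 hij), mul_zero]

end negFourCycleWithPendants

end SignedGraph

/-! ### Comparison of Estrada indices -/

namespace SignedGraph

section extremal

variable {V : Type*} [Fintype V] [DecidableEq V] {Γ : SignedGraph V} {c : V → Bool} {n : ℕ}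

theorem trace_colorGram_pow_eq_sum (κ : Bool) (k : ℕ) :
    (colorGram Γ.adjMatrix c κ ^ k).trace = ∑ j, Γ.gramEigenvalues c κ j ^ k :=
  (colorGram_posSemidef Γ.adjMatrix c κ).1.trace_pow_eq_sum_eigenvalues_pow k

theorem gramEigenvalues_nonneg (κ : Bool) (j : V) : 0 ≤ Γ.gramEigenvalues c κ j :=
  (colorGram_posSemidef Γ.adjMatrix c κ).eigenvalues_nonneg j

/-- The trace of `A ^ 2` counts every edge twice, and each colour class carries half of it. -/
theorem sum_gramEigenvalues (hc : Γ.adjMatrix.IsColoredBy c) (κ : Bool) :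
    ∑ j, Γ.gramEigenvalues c κ j = Γ.graph.edgeSet.ncard := by
  have h1 := hc.two_mul_trace_colorGram_pow Γ.adjMatrix_isHermitian κ one_ne_zero
  rw [trace_colorGram_pow_eq_sum, mul_one, Γ.trace_adjMatrix_sq] at h1
  simpa using h1

theorem IsNegCycle.trace_colorGram_pow_le (hu : Γ.IsUnicyclic) (hV : Fintype.card V = n)
    (hn : 4 ≤ n) {g : ℕ} (hg : 3 ≤ g) {b : ℕ → V} (hb : Γ.IsNegCycle g b)
    (hc : Γ.adjMatrix.IsColoredBy c) (κ : Bool) (k : ℕ) (hk : k ≠ 0) :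
    (colorGram Γ.adjMatrix c κ ^ k).trace ≤
      (colorGram (negFourCycleWithPendants n).adjMatrix
        (fun i => decide ((i : ℕ) = 0 ∨ (i : ℕ) = 2)) true ^ k).trace := by
  rw [trace_colorGram_negFourCycleWithPendants_pow hn hk, trace_colorGram_pow_eq_sum]
  refine sum_pow_le_of_sum_eq (gramEigenvalues_nonneg κ) ?_ (hb.exists_two_le hg hc κ)
    (by positivity) hk
  rw [sum_gramEigenvalues hc, hu.2, hV]

end extremal

variable {V : Type*} [Fintype V] {Γ : SignedGraph V} {n : ℕ}

theorem IsUnbalancedBipartiteUnicyclic.estradaIndex_le (h : Γ.IsUnbalancedBipartiteUnicyclic)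
    (hn : 4 ≤ n) (hV : Fintype.card V = n) :
    Γ.estradaIndex ≤ (negFourCycleWithPendants n).estradaIndex := by
  classical
  obtain ⟨g, hg, b, hb⟩ := exists_isNegCycle h.1 h.2.2
  obtain ⟨c, hc⟩ := Γ.exists_isColoredBy h.2.1
  exact estradaIndex_le_of_trace_colorGram (by simpa using hV) hc
    isColoredBy_negFourCycleWithPendants (hb.trace_colorGram_pow_le h.1 hV hn hg hc true)

theorem IsUnbalancedBipartiteUnicyclic.switchingEquivalent_of_estradaIndex_eq
    (h : Γ.IsUnbalancedBipartiteUnicyclic) (hn : 4 ≤ n) (hV : Fintype.card V = n)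
    (he : Γ.estradaIndex = (negFourCycleWithPendants n).estradaIndex) :
    Γ.SwitchingEquivalent (negFourCycleWithPendants n) := by
  classical
  obtain ⟨g, hg, b, hb⟩ := exists_isNegCycle h.1 h.2.2
  obtain ⟨c, hc⟩ := Γ.exists_isColoredBy h.2.1
  -- Both colour classes are needed, since the pendant vertices may turn out to hang from either
  -- one.
  have key (κ : Bool) := of_sum_sq_eq (m := n) (gramEigenvalues_nonneg (Γ := Γ) (c := c) κ)
    (by rw [sum_gramEigenvalues hc, h.1.2, hV]) (hb.exists_two_le hg hc κ) (by positivity) (by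
      rw [← trace_colorGram_pow_eq_sum, ← trace_colorGram_negFourCycleWithPendants_pow hn
        two_ne_zero]
      exact trace_colorGram_pow_eq_of_estradaIndex_eq (by simpa using hV) hc
        isColoredBy_negFourCycleWithPendants (hb.trace_colorGram_pow_le h.1 hV hn hg hc κ) he
        two_ne_zero)
  obtain rfl := hb.length_eq_four hg hc (fun κ => (key κ).1) fun κ => (key κ).2
  obtain ⟨b', hb', hadj⟩ := hb.exists_adj_of_four h.1 hc (fun κ => (key κ).1) fun κ => (key κ).2
  exact hb'.switchingEquivalent h.1 hadj hn hV

end SignedGraph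

theorem theorem3p6 :
    (∀ (V : Type*) [Fintype V] (Γ : SignedGraph V), Γ.IsUnicyclic →
      (Γ.PairingProperty ↔ Γ.graph.IsBipartite)) ∧
    (∀ n : ℕ, 4 ≤ n →
      (SignedGraph.negFourCycleWithPendants n).IsUnbalancedBipartiteUnicyclic ∧
      ∀ (V : Type*) [Fintype V] (Γ : SignedGraph V), Fintype.card V = n →
        Γ.IsUnbalancedBipartiteUnicyclic →
        Γ.estradaIndex ≤ (SignedGraph.negFourCycleWithPendants n).estradaIndex ∧
        (Γ.estradaIndex = (SignedGraph.negFourCycleWithPendants n).estradaIndex ↔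
          Γ.SwitchingEquivalent (SignedGraph.negFourCycleWithPendants n))) :=
  ⟨fun _ _ _ hu => ⟨fun h => h.isBipartite hu, SignedGraph.pairingProperty_of_isBipartite⟩,
    fun _ hn => ⟨SignedGraph.isUnbalancedBipartiteUnicyclic_negFourCycleWithPendants hn,
      fun _ _ _ hV h => ⟨h.estradaIndex_le hn hV,
        fun he => h.switchingEquivalent_of_estradaIndex_eq hn hV he,
        fun he => he.estradaIndex_eq⟩⟩⟩
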